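/- Let $V$ be a finite-dimensional $\mathbb{Q}$-vector space with a symmetric bilinear form $Q$, let $k\ge 0$ be an integer, and let $\mathbb{D}$ be the period domain of Hodge structures on $V$ of weight $w=2k$ and of a given type $\mathbf{h}=(h^{p,w-p})_{0\le p\le w}$ that are polarized by $Q$: its points are the Hodge filtrations $(F^p)$ of this type with $Q(F^p,F^{w-p+1})=0$ and $Q(Cx,\overline{x})>0$ for $0\ne x\in V_\mathbb{C}$, where $C$ acts on $V^{p,q}$ as $i^{p-q}$. Let $\mathcal{F}=\mathcal{F}^{k+1}$ be the holomorphic vector bundle on $\mathbb{D}$ with fibre $F^{k+1}$ at $(F^p)$, with the hermitian metric $$(e,e')=\tfrac12\,Q(Ce,\overline{e'}).$$ For $v\in V_\mathbb{R}$ let $s_v:\mathcal{F}\to\mathcal{O}_\mathbb{D}$ be the linear form $s_v(e)=Q(e,v)$. For $v_1,\dots,v_r\in V_\mathbb{R}$ ($r\ge 0$) let $K(v_1,\dots,v_r)$ be the Koszul complex of $s=(s_{v_1},\dots,s_{v_r}):\mathcal{F}^{\oplus r}\to\mathcal{O}_\mathbb{D}$, that is, $\wedge(\mathcal{F}^{\oplus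 r})$ with the contraction by $s$ as differential, with the induced metric, its Chern connection $\nabla$ and the grading into even and odd exterior powers. Let $s^*$ be the adjoint of $s$ on $\wedge(\mathcal{F}^{\oplus r})$, let $\nabla_{v_1,\dots,v_r}=\nabla+i\sqrt{2\pi}\,(s+s^*)$, which is a superconnection, and put $$\varphi(v_1,\dots,v_r)=e^{-\pi\sum_i Q(v_i,v_i)}\;\mathrm{tr}_s\bigl(e^{\nabla_{v_1,\dots,v_r}^2}\bigr),$$ a differential form on $\mathbb{D}$, where $\mathrm{tr}_s$ is the supertrace. Then for every $z\in\mathbb{D}$ the value $\varphi(v_1,\dots,v_r,z)$ of this form at $z$, as a function of $(v_1,\dots,v_r)$, belongs to $$\mathcal{S}(V_\mathbb{R}^r)\otimes_\mathbb{C}\wedge T_z^*\mathbb{D},$$ where $\mathcal{S}(V_\mathbb{R}^r)$ is the space of complex-valued Schwartz functions on $V_\mathbb{R}^r$ and $T_z^*\mathbb{D}$ is the complexified cotangent space of $\mathbb{D}$ at $z$. -/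

import Mathlib

open scoped TensorProduct

noncomputable section

/-! ## Real and complex points of a rational quadratic space -/

namespace SuperPeriod

section Extension

variable (V : Type*) [AddCommGroup V] [Module ℚ V]

/-- The real vector space obtained from `V` by extension of scalars. -/
abbrev RealPts : Type _ := ℝ ⊗[ℚ] V

/-- The complex vector space obtained from `V` by extension of scalars. -/
abbrev ComplexPts : Type _ := ℂ ⊗[ℚ] V

/-- A norm on the real points (the sup norm in some coordinates). All norms on this
finite-dimensional space are equivalent, so the Schwartz space does not depend on the choice. -/
instance [FiniteDimensional ℚ V] : NormedAddCommGroup (RealPts V) :=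
  NormedAddCommGroup.induced (RealPts V) (Fin (Module.finrank ℝ (RealPts V)) → ℝ)
    (Module.finBasis ℝ (RealPts V)).equivFun.toLinearMap
    (Module.finBasis ℝ (RealPts V)).equivFun.injective

instance [FiniteDimensional ℚ V] : NormedSpace ℝ (RealPts V) :=
  NormedSpace.induced ℝ (RealPts V) (Fin (Module.finrank ℝ (RealPts V)) → ℝ)
    (Module.finBasis ℝ (RealPts V)).equivFun.toLinearMap

variable {V}

/-- The inclusion of the real points in the complex points, `a ⊗ v ↦ (a : ℂ) ⊗ v`. -/
def realToComplex : RealPts V →ₗ[ℚ] ComplexPts V :=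
  (Complex.ofRealAm.toLinearMap.restrictScalars ℚ).rTensor V

/-- Complex conjugation on the complex points, `a ⊗ v ↦ conj a ⊗ v`. -/
def conjC : ComplexPts V →ₛₗ[starRingEnd ℂ] ComplexPts V where
  toFun := (Complex.conjAe.toLinearMap.restrictScalars ℚ).rTensor V
  map_add' := map_add _
  map_smul' c x := by
    induction x using TensorProduct.induction_on with
    | zero => simp
    | tmul a v => simp [TensorProduct.smul_tmul']
    | add x y hx hy => simp only [smul_add, map_add, hx, hy]

/-- The complex bilinear extension of `Q`. -/
abbrev complexForm (Q : LinearMap.BilinForm ℚ V) : LinearMap.BilinForm ℂ (ComplexPts V) :=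
  Q.baseChange ℂ

/-- The real bilinear extension of `Q`. -/
abbrev realForm (Q : LinearMap.BilinForm ℚ V) : LinearMap.BilinForm ℝ (RealPts V) :=
  Q.baseChange ℝ

end Extension

/-! ## Polarized Hodge structures and the period domain -/

section Hodge

variable {V : Type*} [AddCommGroup V] [Module ℚ V]

/-- The piece `V^{p,w-p} = F^p ∩ conj (F^{w-p})` of a filtration. -/
def hodgePiece (F : ℕ → Submodule ℂ (ComplexPts V)) (w p : ℕ) :
    Submodule ℂ (ComplexPts V) :=
  F p ⊓ (F (w - p)).comap conjC

variable (V) in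
/-- A rational Hodge structure on `V` of weight `w` with Hodge numbers `h^{p,w-p}` zero outside
`0 ≤ p ≤ w`, given by its Hodge filtration
`V_ℂ = F^0 ⊇ F^1 ⊇ ⋯ ⊇ F^w ⊇ F^{w+1} = 0`. -/
structure HodgeStructure (w : ℕ) where
  /-- the Hodge filtration -/
  F : ℕ → Submodule ℂ (ComplexPts V)
  antitone : Antitone F
  F_zero : F 0 = ⊤
  F_top : F (w + 1) = ⊥
  /-- the Hodge decomposition `V_ℂ = ⨁ V^{p,w-p}` -/
  isInternal : DirectSum.IsInternal (fun p : Fin (w + 1) => hodgePiece F w p)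

/-- The Weil operator `C`, acting on `V^{p,q}` by `i^{p-q}`. -/
def HodgeStructure.weil {w : ℕ} (S : HodgeStructure V w) :
    ComplexPts V →ₗ[ℂ] ComplexPts V :=
  DirectSum.toModule ℂ (Fin (w + 1)) (ComplexPts V)
      (fun p => (Complex.I ^ ((p : ℤ) - ((w : ℤ) - (p : ℤ)))) • (hodgePiece S.F w p).subtype) ∘ₗ
    (LinearEquiv.ofBijective
      (DirectSum.coeLinearMap (fun p : Fin (w + 1) => hodgePiece S.F w p)) S.isInternal).symm

open scoped ComplexOrder in
/-- The period domain of Hodge structures of even weight `2k` and type `h` on `V` polarized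
by `Q` (`h p` is the Hodge number `h^{p,2k-p}`). -/
structure PeriodDomain (Q : LinearMap.BilinForm ℚ V) (k : ℕ) (h : Fin (2 * k + 1) → ℕ)
    extends HodgeStructure V (2 * k) where
  finrank_piece : ∀ p : Fin (2 * k + 1), Module.finrank ℂ (hodgePiece F (2 * k) p) = h p
  /-- first Riemann bilinear relation: `Q (F^p, F^{w-p+1}) = 0` -/
  riemann_orthogonal : ∀ p ≤ 2 * k + 1, ∀ x ∈ F p, ∀ y ∈ F (2 * k + 1 - p),
    complexForm Q x y = 0
  /-- second Riemann bilinear relation: `Q (C x, conj x) > 0` for nonzero `x` -/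
  riemann_positive : ∀ x : ComplexPts V, x ≠ 0 →
    0 < complexForm Q (toHodgeStructure.weil x) (conjC x)

end Hodge

/-! ## Forms and superconnections over a coordinate domain in `ℂⁿ` -/

section Superconnection

variable {n : ℕ}

/-- The complexified cotangent space of `ℂⁿ` at any of its points: `ℝ`-linear maps `ℂⁿ → ℂ`. -/
abbrev Cotangent (n : ℕ) : Type := (Fin n → ℂ) →ₗ[ℝ] ℂ

/-- Complex-valued differential forms at a point of `ℂⁿ`: the exterior algebra `∧ T^*`. -/
abbrev Forms (n : ℕ) : Type := ExteriorAlgebra ℂ (Cotangent n)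

/-- A basis of `∧ T^*`, used only to differentiate and to exponentiate coordinatewise. -/
def formsBasis (n : ℕ) :
    Module.Basis (Finset (Fin (Module.finrank ℂ (Cotangent n)))) ℂ (Forms n) :=
  (Module.finBasis ℂ (Cotangent n)).ExteriorAlgebra

/-- The real directional derivative at `x` along `t` of a function with values in a
finite-dimensional complex vector space, computed in the coordinates of a basis. -/
def coordDeriv {I M : Type*} [Fintype I] [AddCommGroup M] [Module ℂ M]
    (b : Module.Basis I ℂ M) (f : (Fin n → ℂ) → M) (x t : Fin n → ℂ) : M :=
  ∑ i, (fderiv ℝ (fun y => b.repr (f y) i) x t) • b i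

/-- The one-form `dx_j`, where `z_j = x_j + i y_j`. -/
def dx (j : Fin n) : Cotangent n :=
  Complex.ofRealCLM.toLinearMap ∘ₗ Complex.reLm ∘ₗ LinearMap.proj j

/-- The one-form `dy_j`, where `z_j = x_j + i y_j`. -/
def dy (j : Fin n) : Cotangent n :=
  Complex.ofRealCLM.toLinearMap ∘ₗ Complex.imLm ∘ₗ LinearMap.proj j

/-- The exterior derivative `dα = ∑ⱼ (dx_j ∧ ∂α/∂x_j + dy_j ∧ ∂α/∂y_j)` of a form `α`. -/
def extD (α : (Fin n → ℂ) → Forms n) (x : Fin n → ℂ) : Forms n :=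
  ∑ j, (ExteriorAlgebra.ι ℂ (dx j) * coordDeriv (formsBasis n) α x (Pi.single j 1) +
    ExteriorAlgebra.ι ℂ (dy j) * coordDeriv (formsBasis n) α x (Pi.single j Complex.I))

/-- The `(1,0)`-part `∂f` of the differential of a function `f`, at `x`:
`t ↦ (df(t) - i df(i t)) / 2`. -/
def delOne (f : (Fin n → ℂ) → ℂ) (x : Fin n → ℂ) : Cotangent n where
  toFun t := (fderiv ℝ f x t - Complex.I * fderiv ℝ f x (Complex.I • t)) / 2
  map_add' s t := by simp only [smul_add, map_add]; ring
  map_smul' c t := by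
    simp only [smul_comm Complex.I c t, map_smul, Complex.real_smul, RingHom.id_apply]; ring

variable {κ : Type*} [Fintype κ] [DecidableEq κ]

/-- The matrix of one-forms `G⁻¹ ∂G` of the Chern connection of a hermitian holomorphic vector
bundle with a holomorphic frame `(e_a)`, where `G a b = (e_b, e_a)` (hermitian metrics are linear
in the first variable): `∇ e_b = ∑ₐ chernMatrix G a b ⊗ e_a`. -/
def chernMatrix (G : (Fin n → ℂ) → Matrix κ κ ℂ) (x : Fin n → ℂ) (a b : κ) : Cotangent n :=
  ∑ c, ((G x)⁻¹ a c) • delOne (fun y => G y c b) x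

/-- The adjoint of an endomorphism with matrix `u` for the hermitian metric with
`G a b = (e_b, e_a)`. -/
def metricAdjoint (G u : Matrix κ κ ℂ) : Matrix κ κ ℂ := G⁻¹ * u.conjTranspose * G

/-- The superconnection `∇ + u` on a trivialized super vector bundle, where `∇` is the Chern
connection of the metric with Gram matrix `G` and `u` is an odd endomorphism.
A section `∑ σ_a ⊗ e_a` of `∧ T^* ⊗ E` is given by its coordinates. The endomorphism `u` acts
by the Koszul rule of signs, `u (σ_a ⊗ e_a) = (-1)^{deg σ_a} σ_a ⊗ u e_a`; the sign
`(-1)^{deg}` is the grade involution `CliffordAlgebra.involute` of the exterior algebra. -/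
def superconnection (G u : (Fin n → ℂ) → Matrix κ κ ℂ) (σ : (Fin n → ℂ) → κ → Forms n) :
    (Fin n → ℂ) → κ → Forms n :=
  fun x a => extD (fun y => σ y a) x +
    ∑ b, ExteriorAlgebra.ι ℂ (chernMatrix G x a b) * σ x b +
    ∑ b, u x a b • CliffordAlgebra.involute (σ x b)

/-- The square at `x` of an operator `D` on sections whose square is even and linear over
differential forms: the endomorphism of `∧ T^* ⊗ E_x` with
`η ⊗ e_b ↦ η ∧ (D (D e_b))(x)`. -/
def curvature (D : ((Fin n → ℂ) → κ → Forms n) → ((Fin n → ℂ) → κ → Forms n))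
    (x : Fin n → ℂ) : (κ → Forms n) →ₗ[ℂ] (κ → Forms n) :=
  LinearMap.pi fun a => ∑ b,
    (LinearMap.mulRight ℂ (D (D (fun _ => Pi.single b 1)) x a)) ∘ₗ LinearMap.proj b

/-- The exponential of an endomorphism of the finite-dimensional space `∧ T^* ⊗ E_x`. -/
def expEnd (T : (κ → Forms n) →ₗ[ℂ] (κ → Forms n)) : (κ → Forms n) →ₗ[ℂ] (κ → Forms n) :=
  let b := Pi.basis (fun _ : κ => formsBasis n)
  Matrix.toLin b b (NormedSpace.exp (LinearMap.toMatrix b b T))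

/-- The supertrace with values in `∧ T^*` of a form-linear endomorphism of `∧ T^* ⊗ E_x`, where the
frame vector `e_a` has degree `deg a`; it maps `ω ⊗ u` to `ω tr_s(u)`. -/
def supertrace (deg : κ → ℕ) (T : (κ → Forms n) →ₗ[ℂ] (κ → Forms n)) : Forms n :=
  ∑ a, (-1 : ℂ) ^ deg a • T (Pi.single a 1) a

end Superconnection

/-! ## Koszul complexes -/

section Koszul

variable {ι : Type*} [Fintype ι] [LinearOrder ι]

/-- The frame `e_{i_1} ∧ ⋯ ∧ e_{i_k}` (`i_1 < ⋯ < i_k`) of the exterior algebra, indexed by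
finite sets `{i_1, …, i_k}`. -/
def wedgeBasis (ι : Type*) [Fintype ι] [LinearOrder ι] :
    Module.Basis (Finset ι) ℂ (ExteriorAlgebra ℂ (ι → ℂ)) :=
  (Pi.basisFun ℂ ι).ExteriorAlgebra

/-- The differential of the Koszul complex of a linear form with `e_i ↦ s i`:
`e_1 ∧ ⋯ ∧ e_k ↦ ∑ (-1)^{i+1} s(e_i) e_1 ∧ ⋯ ê_i ⋯ ∧ e_k`, i.e. contraction with `s`. -/
def koszulMatrix (s : ι → ℂ) : Matrix (Finset ι) (Finset ι) ℂ :=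
  LinearMap.toMatrix (wedgeBasis ι) (wedgeBasis ι)
    (CliffordAlgebra.contractLeft (Fintype.linearCombination ℂ s))

/-- The Gram matrix of the metric induced on the exterior algebra by the metric with Gram
matrix `G`. It is the matrix of `∧ G`: its `(S, T)` entry is the minor
`det (G_{s,t})_{s ∈ S, t ∈ T}` if `S` and `T` have the same size, and `0` otherwise. -/
def wedgeGram (G : Matrix ι ι ℂ) : Matrix (Finset ι) (Finset ι) ℂ :=
  LinearMap.toMatrix (wedgeBasis ι) (wedgeBasis ι)
    (ExteriorAlgebra.map (Matrix.toLin' G)).toLinearMap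

end Koszul

/-! ## The forms `φ(v_1, …, v_r)` -/

section Phi

variable {V : Type*} [AddCommGroup V] [Module ℚ V] [FiniteDimensional ℚ V]
  {Q : LinearMap.BilinForm ℚ V} {k : ℕ} {h : Fin (2 * k + 1) → ℕ}

/-- A holomorphic chart of the period domain centered at `z`, with a holomorphic trivialization of
the flag of Hodge bundles over it: on an open neighbourhood `U` of `0` in `ℂⁿ`, the Hodge
filtration of the point `pt x` is `g x` applied to that of `z`, with `g` holomorphic.
Here `F^•` varies in flags satisfying the first bilinear relation, so that the holomorphic tangent
space at `z` is `so(V_ℂ, Q) / {X ∈ so(V_ℂ, Q) | X F^p ⊆ F^p}`, and the last two conditions say that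
the differential of `pt` is an isomorphism from `ℂⁿ` to it. -/
structure HolomorphicChart (z : PeriodDomain Q k h) (n : ℕ) where
  U : Set (Fin n → ℂ)
  isOpen : IsOpen U
  zero_mem : 0 ∈ U
  pt : (Fin n → ℂ) → PeriodDomain Q k h
  g : (Fin n → ℂ) → Module.End ℂ (ComplexPts V)
  holomorphic : ∀ l : Module.Dual ℂ (Module.End ℂ (ComplexPts V)),
    DifferentiableOn ℂ (fun x => l (g x)) U
  g_zero : g 0 = 1
  filtration : ∀ x ∈ U, ∀ p, (pt x).F p = (z.F p).map (g x)
  deriv_injective : ∀ t : Fin n → ℂ,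
    (∀ p, (z.F p).map (coordDeriv (Module.finBasis ℂ _) g 0 t) ≤ z.F p) → t = 0
  deriv_surjective : ∀ X : Module.End ℂ (ComplexPts V),
    (∀ x y, complexForm Q (X x) y + complexForm Q x (X y) = 0) →
    ∃ t : Fin n → ℂ, ∀ p, (z.F p).map (X - coordDeriv (Module.finBasis ℂ _) g 0 t) ≤ z.F p

namespace HolomorphicChart

variable {z : PeriodDomain Q k h} {n : ℕ} (c : HolomorphicChart z n)

/-- A holomorphic frame of the Hodge bundle `F = F^{k+1}` over the chart. -/
def frame (a : Fin (Module.finrank ℂ (z.F (k + 1)))) (x : Fin n → ℂ) : ComplexPts V :=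
  c.g x (Module.finBasis ℂ (z.F (k + 1)) a)

/-- The Gram matrix `(e_b, e_a)` of the Hodge metric `(e, e') = Q (C e, conj e') / 2` on `F`. -/
def gram (x : Fin n → ℂ) :
    Matrix (Fin (Module.finrank ℂ (z.F (k + 1)))) (Fin (Module.finrank ℂ (z.F (k + 1)))) ℂ :=
  fun a b => complexForm Q ((c.pt x).weil (c.frame b x)) (conjC (c.frame a x)) / 2

/-- The index set of the frame of `F^{⊕ r}` made of `r` copies of the frame of `F`. -/
abbrev SumIndex (z : PeriodDomain Q k h) (r : ℕ) : Type :=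
  Fin r ×ₗ Fin (Module.finrank ℂ (z.F (k + 1)))

/-- The Gram matrix of the orthogonal sum `F^{⊕ r}`. -/
def sumGram (r : ℕ) (x : Fin n → ℂ) : Matrix (SumIndex z r) (SumIndex z r) ℂ :=
  fun a b => if (ofLex a).1 = (ofLex b).1 then c.gram x (ofLex a).2 (ofLex b).2 else 0

/-- The linear form `(s_{v_1}, …, s_{v_r}) : F^{⊕ r} → 𝒪`, where `s_v(e) = Q(e, v)`. -/
def sumSection {r : ℕ} (v : Fin r → RealPts V) (x : Fin n → ℂ) : SumIndex z r → ℂ :=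
  fun a => complexForm Q (c.frame (ofLex a).2 x) (realToComplex (v (ofLex a).1))

/-- The Gram matrix of the metric on the Koszul complex `∧ (F^{⊕ r})`. -/
def koszulGram (r : ℕ) (x : Fin n → ℂ) :
    Matrix (Finset (SumIndex z r)) (Finset (SumIndex z r)) ℂ :=
  wedgeGram (c.sumGram r x)

/-- The odd endomorphism `i √(2π) (s + s^*)` of the Koszul complex of
`s = (s_{v_1}, …, s_{v_r})`. -/
def oddPart {r : ℕ} (v : Fin r → RealPts V) (x : Fin n → ℂ) :
    Matrix (Finset (SumIndex z r)) (Finset (SumIndex z r)) ℂ :=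
  (Complex.I * (Real.sqrt (2 * Real.pi) : ℂ)) •
    (koszulMatrix (c.sumSection v x) +
      metricAdjoint (c.koszulGram r x) (koszulMatrix (c.sumSection v x)))

/-- The value at `z` of `φ⁰(v_1, …, v_r) = tr_s(exp(∇_v²))`, in the coordinates of the chart. -/
def phiZero {r : ℕ} (v : Fin r → RealPts V) : Forms n :=
  supertrace Finset.card
    (expEnd (curvature (superconnection (c.koszulGram r) (c.oddPart v)) 0))

/-- The value at `z` of `φ(v_1, …, v_r) = e^{-π ∑ Q(v_i, v_i)} φ⁰(v_1, …, v_r)`, in the coordinates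
of the chart. -/
def phi {r : ℕ} (v : Fin r → RealPts V) : Forms n :=
  (Real.exp (-Real.pi * ∑ i, realForm Q (v i) (v i)) : ℂ) • c.phiZero v

end HolomorphicChart

end Phi

/-- The map `S(E) ⊗ A → A`, `f ⊗ a ↦ f(v) a`, evaluating at `v` an element of the tensor product of
the space of complex Schwartz functions on `E` with a complex vector space `A`. -/
def evalAt {E A : Type*} [NormedAddCommGroup E] [NormedSpace ℝ E] [AddCommGroup A] [Module ℂ A]
    (v : E) : SchwartzMap E ℂ ⊗[ℂ] A →ₗ[ℂ] A :=
  TensorProduct.lift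
    { toFun := fun f => f v • LinearMap.id
      map_add' := fun f g => by simp [add_smul]
      map_smul' := fun a f => by simp [mul_smul] }

end SuperPeriod

end

/-! Write u = i√(2π)(s + s*). Here s is a contraction and s* is exterior multiplication by the
vector dual to s, so both have square zero and ss* + s*s is the scalar |s|²
(`koszulMatrix_add_metricAdjoint_mul_self`). Hence the curvature of ∇ + u is -2π|s|² plus an
endomorphism R of positive form degree (`curvature_superconnection`). R commutes with the scalar and
is nilpotent because form degrees are bounded, so the exponential is e^{-2π|s|²} times a finite sum
of powers of R (`supertrace_expEnd_formOp`). As u is real linear in v, the entries of R are affine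
in v. Thus φ(v) = e^{-πq(v)} P(v) with q(v) = ∑ Q(v_i,v_i) + 2|s_v|² and P of temperate growth.

It remains to see that q is positive definite. For r = 1 let n_a ≥ 0 be the Hodge norm of the
component of v in V^{a,2k-a}. Then Q(v,v) = ∑ ±n_a with sign + at a = k, and n_a = n_{2k-a} since v
is real. Testing s_v on e = C(v_{>k}) gives |s_v|² ≥ 2 ∑_{a>k} n_a, whence q(v) ≥ ∑ n_a
(`exists_majorant`, `dual_norm_bound`). The general case is a sum of such terms.

One analytic point is left: R contains the derivative of s*, which is additive in v once s* is
differentiable at the centre. That reduces to real differentiability of the Weil operator, obtained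
by transporting the projections onto F^p with g on F^p and the conjugate of g on the conjugate
complement (`proj_coordMem`). -/

open scoped TensorProduct

noncomputable section

namespace SuperPeriod

/-! ### Gaussians of quadratic growth are Schwartz functions. -/

section Gaussian

variable {E : Type*} [NormedAddCommGroup E] [NormedSpace ℝ E]

/-- The power is at most N! e^{1+t}, and completing the square bounds t - ct² by 1/(4c). -/
theorem one_add_pow_mul_exp_neg_sq_le {c : ℝ} (hc : 0 < c) (N : ℕ) {t : ℝ} (ht : 0 ≤ t) :
    (1 + t) ^ N * Real.exp (-(c * t ^ 2)) ≤ N.factorial * Real.exp (1 + 1 / (4 * c)) := by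
  have h1 : (1 + t) ^ N ≤ N.factorial * Real.exp (1 + t) := by
    have := Real.pow_div_factorial_le_exp (1 + t) (by positivity) N
    rwa [div_le_iff₀ (by positivity), mul_comm] at this
  have h2 : 1 + t + -(c * t ^ 2) ≤ 1 + 1 / (4 * c) := by
    have : 0 ≤ c * (t - 1 / (2 * c)) ^ 2 := by positivity
    have h3 : c * (t - 1 / (2 * c)) ^ 2 = c * t ^ 2 - t + 1 / (4 * c) := by
      field_simp; ring
    linarith
  calc (1 + t) ^ N * Real.exp (-(c * t ^ 2))
      ≤ N.factorial * Real.exp (1 + t) * Real.exp (-(c * t ^ 2)) := by gcongr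
    _ = N.factorial * Real.exp (1 + t + -(c * t ^ 2)) := by rw [mul_assoc, ← Real.exp_add]
    _ ≤ _ := by gcongr

/-- The exponential of minus a function of temperate growth that grows at least quadratically is
a Schwartz function. -/
theorem exists_schwartzMap_exp_neg {q : E → ℝ} (hq : q.HasTemperateGrowth) {c : ℝ} (hc : 0 < c)
    (hle : ∀ x, c * ‖x‖ ^ 2 ≤ q x) :
    ∃ f : SchwartzMap E ℂ, ∀ x, f x = (Real.exp (-q x) : ℂ) := by
  have hn : (fun x => -q x).HasTemperateGrowth := hq.neg
  have hsm : ContDiff ℝ ((⊤ : ℕ∞) : WithTop ℕ∞) (fun x => Real.exp (-q x)) := Real.contDiff_exp.comp hn.1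
  let f : SchwartzMap E ℝ :=
    { toFun := fun x => Real.exp (-q x)
      smooth' := hsm
      decay' := by
        intro k n
        obtain ⟨l, C, hC, hbd⟩ := hn.norm_iteratedFDeriv_le_uniform n
        refine ⟨n.factorial * (1 + C) ^ n *
          ((k + l * n).factorial * Real.exp (1 + 1 / (4 * c))), fun x => ?_⟩
        have hx := norm_nonneg x
        have h1 : (1 : ℝ) ≤ (1 + ‖x‖) ^ l := one_le_pow₀ (by linarith)
        -- The bound for a composition wants derivatives of order i ≥ 1 bounded by D ^ i. Using 1 +
        -- C instead of C makes D ≥ 1, so that D ≤ D ^ i.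
        have hD1 : (1 : ℝ) ≤ (1 + C) * (1 + ‖x‖) ^ l := by nlinarith
        have key := norm_iteratedFDeriv_comp_le (g := Real.exp) (f := fun x => -q x) (n := n)
          (Real.contDiff_exp (n := ((⊤ : ℕ∞) : WithTop ℕ∞))) hn.1 (mod_cast le_top) x
          (C := Real.exp (-q x))
          (D := (1 + C) * (1 + ‖x‖) ^ l)
          (by
            intro i _
            rw [norm_iteratedFDeriv_eq_norm_iteratedDeriv, iteratedDeriv_eq_iterate,
              Real.iter_deriv_exp, Real.norm_of_nonneg (Real.exp_pos _).le])
          (by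
            intro i hi hin
            refine (hbd i hin x).trans ?_
            calc C * (1 + ‖x‖) ^ l ≤ (1 + C) * (1 + ‖x‖) ^ l := by gcongr; linarith
              _ ≤ _ := le_self_pow₀ hD1 (by omega))
        have hexp : Real.exp (-q x) ≤ Real.exp (-(c * ‖x‖ ^ 2)) := by
          gcongr; exact hle x
        have hk : ‖x‖ ^ k ≤ (1 + ‖x‖) ^ k := by gcongr; linarith
        calc ‖x‖ ^ k * ‖iteratedFDeriv ℝ n (fun x => Real.exp (-q x)) x‖
            ≤ (1 + ‖x‖) ^ k * (n.factorial * Real.exp (-(c * ‖x‖ ^ 2)) *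
                ((1 + C) * (1 + ‖x‖) ^ l) ^ n) := by
              refine mul_le_mul hk (key.trans ?_) (norm_nonneg _) (by positivity)
              gcongr
          _ = n.factorial * (1 + C) ^ n *
                ((1 + ‖x‖) ^ (k + l * n) * Real.exp (-(c * ‖x‖ ^ 2))) := by
              rw [mul_pow, ← pow_mul, pow_add]; ring
          _ ≤ _ := by
              exact mul_le_mul_of_nonneg_left (one_add_pow_mul_exp_neg_sq_le hc _ hx) (by positivity) }
  refine ⟨SchwartzMap.postcompCLM Complex.ofRealCLM f, fun x => ?_⟩
  rw [SchwartzMap.postcompCLM_apply]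
  rfl

end Gaussian

/-! ### Exterior algebra: contraction, multiplication and the adjoint of the Koszul differential. -/

section Wedge

section Basis

variable {R M I : Type*} [CommRing R] [AddCommGroup M] [Module R M] [LinearOrder I]
  (b : Module.Basis I R M)

/-- A new least index prepends one factor to the ordered wedge without a sign, so computations on
the frame become inductions on the minimum. -/
theorem basis_insert_lt {m : I} {S : Finset I} (h : ∀ i ∈ S, m < i) :
    b.ExteriorAlgebra (insert m S) = ExteriorAlgebra.ι R (b m) * b.ExteriorAlgebra S := by
  have hm : m ∉ S := fun hm => lt_irrefl _ (h m hm)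
  have hcard : (insert m S).card = S.card + 1 := Finset.card_insert_of_notMem hm
  have hmono : StrictMono (Fin.cons m (S.orderEmbOfFin rfl) : Fin (S.card + 1) → I) :=
    Fin.strictMono_cons.2
      ⟨fun j => h _ (Finset.orderEmbOfFin_mem _ _ _), (S.orderEmbOfFin rfl).strictMono⟩
  have hcons := Finset.orderEmbOfFin_unique hcard (f := Fin.cons m (S.orderEmbOfFin rfl))
    (fun x => by
      refine Fin.cases ?_ (fun j => ?_) x
      · simp
      · simp [Finset.orderEmbOfFin_mem]) hmono
  rw [ExteriorAlgebra.basis_apply_ofCard b hcard, ExteriorAlgebra.basis_apply_ofCard b rfl,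
    ExteriorAlgebra.ιMulti_family, ExteriorAlgebra.ιMulti_family,
    Set.powersetCard.ofFinEmbEquiv_symm_apply, Set.powersetCard.ofFinEmbEquiv_symm_apply,
    ExteriorAlgebra.ιMulti_succ_apply]
  have h0 : (insert m S).orderEmbOfFin hcard 0 = m := (congrFun hcons 0).symm
  have ht : ∀ j : Fin S.card, (insert m S).orderEmbOfFin hcard j.succ = S.orderEmbOfFin rfl j :=
    fun j => (congrFun hcons j.succ).symm
  congr 1
  · exact congrArg (fun i => ExteriorAlgebra.ι R (b i)) h0
  · congr 1
    funext j
    exact congrArg b (ht j)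

theorem basis_empty : b.ExteriorAlgebra ∅ = 1 := by
  rw [ExteriorAlgebra.basis_apply_ofCard (n := 0) b Finset.card_empty]
  exact ExteriorAlgebra.ιMulti_zero_apply _

theorem contract_basis_insert_lt (d : Module.Dual R M) {m : I} {S : Finset I}
    (h : ∀ i ∈ S, m < i) :
    CliffordAlgebra.contractLeft d (b.ExteriorAlgebra (insert m S)) =
      d (b m) • b.ExteriorAlgebra S -
        ExteriorAlgebra.ι R (b m) * CliffordAlgebra.contractLeft d (b.ExteriorAlgebra S) := by
  rw [basis_insert_lt b h]
  exact CliffordAlgebra.contractLeft_ι_mul _ _ _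

theorem contract_basis_of_notMem (m : I) {S : Finset I} (hm : m ∉ S) :
    CliffordAlgebra.contractLeft (b.coord m) (b.ExteriorAlgebra S) = 0 := by
  induction S using Finset.induction_on_min with
  | empty => rw [basis_empty]; exact CliffordAlgebra.contractLeft_one _ _
  | insert a S ha ih =>
    rw [Finset.mem_insert, not_or] at hm
    rw [contract_basis_insert_lt b _ ha, ih hm.2]
    simp [Ne.symm hm.1]

/-- The sign itself never matters: duality of the frames only needs some multiple, and integrality
makes the matrix entries real. -/
theorem exists_contract_basis_of_mem {m : I} {S : Finset I} (hm : m ∈ S) :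
    ∃ ε : ℤ, CliffordAlgebra.contractLeft (b.coord m) (b.ExteriorAlgebra S) =
      ε • b.ExteriorAlgebra (S.erase m) := by
  induction S using Finset.induction_on_min with
  | empty => simp at hm
  | insert a S ha ih =>
    have haS : a ∉ S := fun h => lt_irrefl _ (ha a h)
    rcases eq_or_ne m a with rfl | hne
    · refine ⟨1, ?_⟩
      rw [contract_basis_insert_lt b _ ha, contract_basis_of_notMem b m haS,
        Finset.erase_insert haS]
      simp
    · obtain ⟨ε, hε⟩ := ih (Finset.mem_of_mem_insert_of_ne hm hne)
      refine ⟨-ε, ?_⟩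
      rw [contract_basis_insert_lt b _ ha, hε, Finset.erase_insert_of_ne hne.symm,
        basis_insert_lt b (fun i hi => ha i (Finset.mem_of_mem_erase hi))]
      simp [hne.symm, -zsmul_eq_mul]

variable {N : Type*} [AddCommGroup N] [Module R N] (f : N →ₗ[R] Module.Dual R M)

/-- Iterated contractions with the linear forms `f a`, as an algebra map to the endomorphisms with
the opposite multiplication. -/
def contractHom : ExteriorAlgebra R N →ₐ[R] (Module.End R (ExteriorAlgebra R M))ᵐᵒᵖ :=
  ExteriorAlgebra.lift R ⟨(MulOpposite.opLinearEquiv R).toLinearMap ∘ₗ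
    CliffordAlgebra.contractLeft ∘ₗ f, fun d => by
      apply MulOpposite.unop_injective
      ext x
      exact CliffordAlgebra.contractLeft_contractLeft _ _⟩

/-- The pairing of exterior algebras induced by `f`. -/
def wedgePairing : ExteriorAlgebra R N →ₗ[R] ExteriorAlgebra R M →ₗ[R] R :=
  LinearMap.mk₂ R (fun y x => ExteriorAlgebra.algebraMapInv ((contractHom f y).unop x))
    (by simp) (by simp) (by simp) (by simp)

theorem wedgePairing_one (x : ExteriorAlgebra R M) :
    wedgePairing f 1 x = ExteriorAlgebra.algebraMapInv x := by
  simp [wedgePairing]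

/-- The opposite multiplication in `contractHom` lets the leftmost factor contract first, so left
multiplication and contraction are transposes of each other without signs. -/
theorem wedgePairing_ι_mul (a : N) (y : ExteriorAlgebra R N) (x : ExteriorAlgebra R M) :
    wedgePairing f (ExteriorAlgebra.ι R a * y) x =
      wedgePairing f y (CliffordAlgebra.contractLeft (f a) x) := by
  simp only [wedgePairing, LinearMap.mk₂_apply, map_mul, MulOpposite.unop_mul,
    Module.End.mul_apply]
  congr 2
  simp [contractHom]

theorem algebraMapInv_basis (S : Finset I) :
    ExteriorAlgebra.algebraMapInv (b.ExteriorAlgebra S) = if S = ∅ then 1 else 0 := by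
  induction S using Finset.induction_on_min with
  | empty => rw [basis_empty]; simp
  | insert a S ha ih =>
    rw [basis_insert_lt b ha, map_mul, ExteriorAlgebra.algebraMapInv]
    simp

theorem wedgePairing_basis (c : Module.Basis I R N) (hf : ∀ i, f (c i) = b.coord i)
    (S T : Finset I) :
    wedgePairing f (c.ExteriorAlgebra T) (b.ExteriorAlgebra S) = if S = T then 1 else 0 := by
  induction T using Finset.induction_on_min generalizing S with
  | empty => rw [basis_empty, wedgePairing_one, algebraMapInv_basis]
  | insert m T hm ih =>
    have hmT : m ∉ T := fun h => lt_irrefl _ (hm m h)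
    rw [basis_insert_lt c hm, wedgePairing_ι_mul, hf]
    by_cases hS : S = insert m T
    · subst hS
      rw [contract_basis_insert_lt b _ hm, contract_basis_of_notMem b m hmT]
      simp [ih]
    · by_cases hmS : m ∈ S
      · obtain ⟨ε, hε⟩ := exists_contract_basis_of_mem b hmS
        have : S.erase m ≠ T := fun h => hS (by rw [← h, Finset.insert_erase hmS])
        simp [hε, ih, hS, this, -zsmul_eq_mul]
      · simp [contract_basis_of_notMem b m hmS, hS]

end Basis

variable {ι : Type*} [Fintype ι] [LinearOrder ι]

/-- The linear forms `x ↦ ∑ x i * s i`. -/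
def dotForm (ι : Type*) [Fintype ι] : (ι → ℂ) →ₗ[ℂ] Module.Dual ℂ (ι → ℂ) where
  toFun s := Fintype.linearCombination ℂ s
  map_add' s t := by
    ext i; simp [Fintype.linearCombination_apply, mul_add, Finset.sum_add_distrib]
  map_smul' a s := by
    ext i; simp [Fintype.linearCombination_apply, Finset.mul_sum, mul_left_comm]

theorem dotForm_basisFun (i : ι) : dotForm ι (Pi.basisFun ℂ ι i) = (Pi.basisFun ℂ ι).coord i := by
  ext j
  simp [dotForm, Fintype.linearCombination_apply, Pi.single_apply, eq_comm]

theorem wedgePairing_wedgeBasis (S T : Finset ι) :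
    wedgePairing (dotForm ι) (wedgeBasis ι T) (wedgeBasis ι S) = if S = T then 1 else 0 :=
  wedgePairing_basis _ _ _ dotForm_basisFun S T

theorem wedgePairing_wedgeBasis_left (S : Finset ι) (x : ExteriorAlgebra ℂ (ι → ℂ)) :
    wedgePairing (dotForm ι) (wedgeBasis ι S) x = (wedgeBasis ι).repr x S := by
  conv_lhs => rw [← (wedgeBasis ι).sum_repr x]
  rw [map_sum]
  simp only [map_smul, LinearMap.sum_apply, LinearMap.smul_apply, wedgePairing_wedgeBasis]
  simp

theorem wedgePairing_wedgeBasis_right (S : Finset ι) (x : ExteriorAlgebra ℂ (ι → ℂ)) :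
    wedgePairing (dotForm ι) x (wedgeBasis ι S) = (wedgeBasis ι).repr x S := by
  conv_lhs => rw [← (wedgeBasis ι).sum_repr x]
  rw [map_sum]
  simp only [map_smul, LinearMap.sum_apply, LinearMap.smul_apply, wedgePairing_wedgeBasis]
  simp

/-- The matrix of the exterior multiplication by a vector. -/
def wedgeMatrix (s : ι → ℂ) : Matrix (Finset ι) (Finset ι) ℂ :=
  LinearMap.toMatrix (wedgeBasis ι) (wedgeBasis ι) (LinearMap.mulLeft ℂ (ExteriorAlgebra.ι ℂ s))

/-- The frame is dual to itself under the pairing, so an entry of either matrix is the pairing of `ι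
s * e_T` with `e_S`. -/
theorem koszulMatrix_transpose (s : ι → ℂ) : (koszulMatrix s).transpose = wedgeMatrix s := by
  ext S T
  rw [Matrix.transpose_apply, koszulMatrix, wedgeMatrix, LinearMap.toMatrix_apply,
    LinearMap.toMatrix_apply, LinearMap.mulLeft_apply, ← wedgePairing_wedgeBasis_left,
    ← wedgePairing_wedgeBasis_right, wedgePairing_ι_mul]
  rfl

/-- The Koszul differential depends linearly on the linear form. -/
def koszulLinear (ι : Type*) [Fintype ι] [LinearOrder ι] :
    (ι → ℂ) →ₗ[ℂ] Matrix (Finset ι) (Finset ι) ℂ :=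
  (LinearMap.toMatrix (wedgeBasis ι) (wedgeBasis ι)).toLinearMap ∘ₗ
    CliffordAlgebra.contractLeft ∘ₗ dotForm ι

theorem koszulLinear_apply (s : ι → ℂ) : koszulLinear ι s = koszulMatrix s := rfl

/-- Contraction with a coordinate form has integer entries; by linearity, conjugating a Koszul
matrix therefore only conjugates the coefficients of s. -/
theorem star_koszulMatrix_single (i : ι) (S T : Finset ι) :
    star (koszulMatrix (Pi.single i 1 : ι → ℂ) S T) = koszulMatrix (Pi.single i 1) S T := by
  have h : (Fintype.linearCombination ℂ (Pi.single i 1 : ι → ℂ)) = (Pi.basisFun ℂ ι).coord i := by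
    rw [← dotForm_basisFun]; simp [dotForm]
  rw [koszulMatrix, LinearMap.toMatrix_apply, h]
  by_cases hi : i ∈ T
  · obtain ⟨ε, hε⟩ := exists_contract_basis_of_mem (Pi.basisFun ℂ ι) hi
    rw [wedgeBasis, hε]
    rw [map_zsmul, Module.Basis.repr_self]
    by_cases hS : T.erase i = S <;> simp [hS]
  · rw [wedgeBasis, contract_basis_of_notMem _ _ hi]
    simp

theorem koszulMatrix_eq_sum (s : ι → ℂ) :
    koszulMatrix s = ∑ i, s i • koszulMatrix (Pi.single i 1) := by
  simp only [← koszulLinear_apply, ← map_smul, ← map_sum]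
  congr 1
  ext j
  simp [Finset.sum_apply, Pi.single_apply]

theorem koszulMatrix_conjTranspose (s : ι → ℂ) :
    (koszulMatrix s).conjTranspose = wedgeMatrix (star s) := by
  rw [← koszulMatrix_transpose, koszulMatrix_eq_sum s, koszulMatrix_eq_sum (star s)]
  ext S T
  simp only [Matrix.conjTranspose_apply, Matrix.transpose_apply, Matrix.sum_apply, star_sum,
    Matrix.smul_apply, star_smul, star_koszulMatrix_single, Pi.star_apply]

theorem koszulMatrix_mul_self (s : ι → ℂ) : koszulMatrix s * koszulMatrix s = 0 := by
  rw [koszulMatrix, ← LinearMap.toMatrix_mul]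
  convert map_zero (LinearMap.toMatrix (wedgeBasis ι) (wedgeBasis ι))
  ext x
  exact CliffordAlgebra.contractLeft_contractLeft _ _

theorem wedgeMatrix_mul_self (s : ι → ℂ) : wedgeMatrix s * wedgeMatrix s = 0 := by
  rw [← koszulMatrix_transpose, ← Matrix.transpose_mul, koszulMatrix_mul_self,
    Matrix.transpose_zero]

/-- Contraction is an antiderivation, so contracting t ∧ x gives s(t) x minus t ∧ (the contraction
of x), and the last term cancels. -/
theorem koszulMatrix_mul_wedgeMatrix_add (s t : ι → ℂ) :
    koszulMatrix s * wedgeMatrix t + wedgeMatrix t * koszulMatrix s =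
      (s ⬝ᵥ t) • (1 : Matrix (Finset ι) (Finset ι) ℂ) := by
  rw [koszulMatrix, wedgeMatrix, ← LinearMap.toMatrix_mul, ← LinearMap.toMatrix_mul, ← map_add,
    ← LinearMap.toMatrix_one (wedgeBasis ι), ← map_smul]
  congr 1
  refine LinearMap.ext fun x => ?_
  have := CliffordAlgebra.contractLeft_ι_mul (Q := (0 : QuadraticForm ℂ (ι → ℂ)))
    (Fintype.linearCombination ℂ s) t x
  simp only [LinearMap.add_apply, Module.End.mul_apply, LinearMap.mulLeft_apply,
    LinearMap.smul_apply, Module.End.one_apply]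
  erw [this]
  simp [Fintype.linearCombination_apply, dotProduct, mul_comm]

theorem wedgeGram_mul (G H : Matrix ι ι ℂ) : wedgeGram (G * H) = wedgeGram G * wedgeGram H := by
  rw [wedgeGram, wedgeGram, wedgeGram, ← LinearMap.toMatrix_mul]
  congr 1
  rw [Matrix.toLin'_mul, ← ExteriorAlgebra.map_comp_map]
  rfl

theorem wedgeGram_one : wedgeGram (1 : Matrix ι ι ℂ) = 1 := by
  rw [wedgeGram, Matrix.toLin'_one, ExteriorAlgebra.map_id, ← LinearMap.toMatrix_one (wedgeBasis ι)]
  rfl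

theorem isUnit_wedgeGram {G : Matrix ι ι ℂ} (hG : IsUnit G) : IsUnit (wedgeGram G) := by
  let φ : Matrix ι ι ℂ →* Matrix (Finset ι) (Finset ι) ℂ :=
    { toFun := wedgeGram, map_one' := wedgeGram_one, map_mul' := wedgeGram_mul }
  exact hG.map φ

/-- ∧G is an algebra map, so it sends s ∧ x to Gs ∧ (∧G)x. -/
theorem wedgeGram_mul_wedgeMatrix (G : Matrix ι ι ℂ) (s : ι → ℂ) :
    wedgeGram G * wedgeMatrix s = wedgeMatrix (G.mulVec s) * wedgeGram G := by
  rw [wedgeGram, wedgeMatrix, wedgeMatrix, ← LinearMap.toMatrix_mul, ← LinearMap.toMatrix_mul]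
  congr 1
  ext x
  exact (map_mul (ExteriorAlgebra.map (Matrix.toLin' G)) _ _).trans
    (by rw [ExteriorAlgebra.map_apply_ι]; rfl)

/-- The adjoint of the Koszul differential is exterior multiplication by the dual vector. -/
theorem metricAdjoint_koszulMatrix {G : Matrix ι ι ℂ} (hG : IsUnit G) (s : ι → ℂ) :
    metricAdjoint (wedgeGram G) (koszulMatrix s) = wedgeMatrix (G⁻¹.mulVec (star s)) := by
  have hW := (Matrix.isUnit_iff_isUnit_det _).1 (isUnit_wedgeGram hG)
  have hd := (Matrix.isUnit_iff_isUnit_det _).1 hG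
  have h := wedgeGram_mul_wedgeMatrix G (G⁻¹.mulVec (star s))
  rw [Matrix.mulVec_mulVec, Matrix.mul_nonsing_inv _ hd, Matrix.one_mulVec] at h
  rw [metricAdjoint, koszulMatrix_conjTranspose, mul_assoc, ← h, ← mul_assoc,
    Matrix.nonsing_inv_mul _ hW, one_mul]

theorem koszulMatrix_add_metricAdjoint_mul_self {G : Matrix ι ι ℂ} (hG : IsUnit G) (s : ι → ℂ) :
    (koszulMatrix s + metricAdjoint (wedgeGram G) (koszulMatrix s)) *
      (koszulMatrix s + metricAdjoint (wedgeGram G) (koszulMatrix s)) =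
      (s ⬝ᵥ G⁻¹.mulVec (star s)) • (1 : Matrix (Finset ι) (Finset ι) ℂ) := by
  rw [metricAdjoint_koszulMatrix hG, ← koszulMatrix_mul_wedgeMatrix_add, mul_add, add_mul, add_mul,
    koszulMatrix_mul_self, wedgeMatrix_mul_self]
  abel

end Wedge

/-! ### Vector-valued functions with coordinates in an algebra: temperate growth in v, or
differentiability in x. -/

section Coordinates

variable {X M M₁ M₂ M₃ : Type*} [AddCommGroup M] [Module ℂ M] [AddCommGroup M₁] [Module ℂ M₁]
  [AddCommGroup M₂] [Module ℂ M₂] [AddCommGroup M₃] [Module ℂ M₃]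

/-- A function with values in a complex vector space whose coordinates belong to an algebra `S` of
scalar functions. -/
def CoordMem (S : Subalgebra ℂ (X → ℂ)) (F : X → M) : Prop :=
  ∀ l : Module.Dual ℂ M, (fun x => l (F x)) ∈ S

namespace CoordMem

variable {S : Subalgebra ℂ (X → ℂ)}

theorem const (m : M) : CoordMem S (fun _ => m) := fun l => S.algebraMap_mem (l m)

theorem add {F G : X → M} (hF : CoordMem S F) (hG : CoordMem S G) :
    CoordMem S (fun x => F x + G x) := fun l => by
  simpa only [map_add] using! S.add_mem (hF l) (hG l)

theorem sum {J : Type*} {s : Finset J} {F : J → X → M} (hF : ∀ j ∈ s, CoordMem S (F j)) :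
    CoordMem S (fun x => ∑ j ∈ s, F j x) := fun l => by
  have := S.sum_mem (fun j hj => hF j hj l)
  convert this using 1
  ext x
  simp

theorem map {F : X → M₁} (hF : CoordMem S F) (L : M₁ →ₗ[ℂ] M₂) :
    CoordMem S (fun x => L (F x)) := fun l => hF (l ∘ₗ L)

theorem sub {F G : X → M} (hF : CoordMem S F) (hG : CoordMem S G) :
    CoordMem S (fun x => F x - G x) := by
  simpa [sub_eq_add_neg] using! hF.add (hG.map (-LinearMap.id))

theorem const_smul {F : X → M} (hF : CoordMem S F) (a : ℂ) : CoordMem S (fun x => a • F x) :=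
  hF.map (a • LinearMap.id)

theorem of_basis {I : Type*} [Fintype I] (b : Module.Basis I ℂ M) {F : X → M}
    (h : ∀ i, (fun x => b.repr (F x) i) ∈ S) : CoordMem S F := fun l => by
  have := S.sum_mem (t := Finset.univ) (fun i _ => S.mul_mem (h i) (S.algebraMap_mem (l (b i))))
  convert this using 1
  ext x
  conv_lhs => rw [← b.sum_repr (F x)]
  simp [-Module.Basis.sum_repr]

theorem scalar {f : X → ℂ} : CoordMem S f ↔ f ∈ S := by
  refine ⟨fun h => h LinearMap.id, fun h l => ?_⟩
  have := S.mul_mem h (S.algebraMap_mem (l 1))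
  convert this using 1
  ext x
  have := l.map_smul (f x) 1
  simpa using this

theorem bilin [FiniteDimensional ℂ M₁] {F : X → M₁} {G : X → M₂} (hF : CoordMem S F)
    (hG : CoordMem S G) (B : M₁ →ₗ[ℂ] M₂ →ₗ[ℂ] M₃) : CoordMem S (fun x => B (F x) (G x)) :=
  fun l => by
  let b := Module.finBasis ℂ M₁
  have := S.sum_mem (t := Finset.univ) (fun i _ => S.mul_mem (hF (b.coord i)) (hG (l ∘ₗ B (b i))))
  convert this using 1
  ext x
  change l (B (F x) (G x)) = _
  conv_lhs => rw [← b.sum_repr (F x)]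
  simp [-Module.Basis.sum_repr]

theorem smul {f : X → ℂ} {F : X → M} (hf : f ∈ S) (hF : CoordMem S F) :
    CoordMem S (fun x => f x • F x) :=
  (scalar.2 hf).bilin hF (LinearMap.lsmul ℂ M)

theorem pi {J : Type*} [Fintype J] [DecidableEq J] {F : X → J → M}
    (h : ∀ j, CoordMem S (fun x => F x j)) : CoordMem S F := by
  have := sum (s := Finset.univ) (fun j _ => (h j).map (LinearMap.single ℂ (fun _ : J => M) j))
  have hF : F = fun x => ∑ j, LinearMap.single ℂ (fun _ : J => M) j (F x j) := by
    funext x j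
    simp [Finset.sum_apply, Pi.single_apply]
  rw [hF]
  exact this

theorem mul {A : Type*} [Ring A] [Algebra ℂ A] [FiniteDimensional ℂ A] {F G : X → A}
    (hF : CoordMem S F) (hG : CoordMem S G) : CoordMem S (fun x => F x * G x) :=
  hF.bilin hG (LinearMap.mul ℂ A)

theorem pow {A : Type*} [Ring A] [Algebra ℂ A] [FiniteDimensional ℂ A] {F : X → A}
    (hF : CoordMem S F) (j : ℕ) : CoordMem S (fun x => F x ^ j) := by
  induction j with
  | zero => simpa using const 1
  | succ j ih => simpa only [pow_succ] using ih.mul hF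

end CoordMem

/-- The algebra of complex functions of temperate growth. -/
def temperateGrowth (E : Type*) [NormedAddCommGroup E] [NormedSpace ℝ E] :
    Subalgebra ℂ (E → ℂ) where
  carrier := {f | f.HasTemperateGrowth}
  mul_mem' hf hg := Function.HasTemperateGrowth.mul hf hg
  add_mem' hf hg := Function.HasTemperateGrowth.add hf hg
  algebraMap_mem' a := Function.HasTemperateGrowth.const a

/-- The algebra of complex functions that are real differentiable at a point. -/
def differentiableAtPoint {E : Type*} [NormedAddCommGroup E] [NormedSpace ℝ E] (x : E) :
    Subalgebra ℂ (E → ℂ) where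
  carrier := {f | DifferentiableAt ℝ f x}
  mul_mem' hf hg := DifferentiableAt.mul hf hg
  add_mem' hf hg := DifferentiableAt.add hf hg
  algebraMap_mem' a := differentiableAt_const a

theorem temperateGrowth_of_linear {E : Type*} [NormedAddCommGroup E] [NormedSpace ℝ E]
    [FiniteDimensional ℝ E] (f : E →ₗ[ℝ] ℂ) : (fun x => f x) ∈ temperateGrowth E :=
  (LinearMap.toContinuousLinearMap f).hasTemperateGrowth

/-- Where f is differentiable, the derivative is a constant plus a linear function of w. No
regularity of f is asked for, so f can be a coefficient of the Chern connection, which does not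
depend on w. -/
theorem fderiv_add_linear_temperateGrowth {E W : Type*} [NormedAddCommGroup E] [NormedSpace ℝ E]
    [NormedAddCommGroup W] [NormedSpace ℝ W] [FiniteDimensional ℝ W] (f : E → ℂ)
    (g : E → W →ₗ[ℝ] ℂ) (x t : E) (hg : ∀ w, DifferentiableAt ℝ (fun y => g y w) x) :
    (fun w => fderiv ℝ (fun y => f y + g y w) x t) ∈ temperateGrowth W := by
  by_cases hf : DifferentiableAt ℝ f x
  · let L : W →ₗ[ℝ] ℂ :=
      { toFun := fun w => fderiv ℝ (fun y => g y w) x t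
        map_add' := fun v w => by
          simp only [map_add]
          rw [fderiv_fun_add (hg v) (hg w)]; rfl
        map_smul' := fun a w => by
          simp only [map_smul]
          rw [fderiv_fun_const_smul (hg w)]; rfl }
    have h : (fun w => fderiv ℝ (fun y => f y + g y w) x t) =
        (fun _ => fderiv ℝ f x t) + fun w => L w := by
      ext w
      rw [fderiv_fun_add hf (hg w)]
      rfl
    rw [h]
    exact Subalgebra.add_mem _ ((temperateGrowth W).algebraMap_mem _) (temperateGrowth_of_linear L)
  -- If f is not differentiable at x, no f + g w is, and all the derivatives take the default value
  -- 0.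
  · have h : (fun w => fderiv ℝ (fun y => f y + g y w) x t) = fun _ => 0 := by
      ext w
      rw [fderiv_zero_of_not_differentiableAt]
      · rfl
      · intro h
        apply hf
        simpa using (h.fun_sub (hg w))
    rw [h]
    exact (temperateGrowth W).algebraMap_mem 0

end Coordinates

/-! ### The degree filtration on forms. -/

section Nilpotent

variable {M : Type*} [AddCommGroup M] [Module ℂ M]

/-- The forms of degree at least `j`. -/
def degreeGE (M : Type*) [AddCommGroup M] [Module ℂ M] (j : ℕ) :
    Submodule ℂ (ExteriorAlgebra ℂ M) :=
  LinearMap.range (ExteriorAlgebra.ι ℂ (M := M)) ^ j * ⊤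

theorem exists_mul_ι_eq (x : ExteriorAlgebra ℂ M) :
    ∀ m : M, ∃ y, x * ExteriorAlgebra.ι ℂ m = ExteriorAlgebra.ι ℂ m * y := by
  induction x using ExteriorAlgebra.induction with
  | algebraMap r => exact fun m => ⟨algebraMap ℂ _ r, Algebra.commutes _ _⟩
  | ι a => exact fun m => ⟨-ExteriorAlgebra.ι ℂ a, by
      rw [mul_neg, eq_neg_iff_add_eq_zero]; exact ExteriorAlgebra.ι_add_mul_swap a m⟩
  | mul a b ha hb =>
    intro m
    obtain ⟨y, hy⟩ := hb m
    obtain ⟨y', hy'⟩ := ha m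
    exact ⟨y' * y, by rw [mul_assoc, hy, ← mul_assoc, hy', mul_assoc]⟩
  | add a b ha hb =>
    intro m
    obtain ⟨y, hy⟩ := ha m
    obtain ⟨y', hy'⟩ := hb m
    exact ⟨y + y', by rw [add_mul, hy, hy', mul_add]⟩

/-- One-forms move from right to left past any form, so the left and right ideals they generate are
comparable and degrees add under products. -/
theorem top_mul_range_ι_le :
    (⊤ : Submodule ℂ (ExteriorAlgebra ℂ M)) * LinearMap.range (ExteriorAlgebra.ι ℂ) ≤
      LinearMap.range (ExteriorAlgebra.ι ℂ) * ⊤ := by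
  rw [Submodule.mul_le]
  rintro x - _ ⟨m, rfl⟩
  obtain ⟨y, hy⟩ := exists_mul_ι_eq x m
  rw [hy]
  exact Submodule.mul_mem_mul ⟨m, rfl⟩ Submodule.mem_top

theorem mul_mem_degreeGE {j : ℕ} {x y : ExteriorAlgebra ℂ M} (hx : x ∈ degreeGE M j)
    (hy : y ∈ degreeGE M 1) : x * y ∈ degreeGE M (j + 1) := by
  have h := Submodule.mul_mem_mul hx hy
  refine (?_ : degreeGE M j * degreeGE M 1 ≤ degreeGE M (j + 1)) h
  rw [degreeGE, degreeGE, degreeGE, pow_one, pow_succ, mul_assoc, mul_assoc]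
  refine mul_le_mul_right (α := Submodule ℂ (ExteriorAlgebra ℂ M)) ?_ _
  rw [← mul_assoc]
  refine (mul_le_mul_left (α := Submodule ℂ (ExteriorAlgebra ℂ M)) top_mul_range_ι_le _).trans ?_
  rw [mul_assoc]
  exact mul_le_mul_right (α := Submodule ℂ (ExteriorAlgebra ℂ M)) le_top _

theorem mem_degreeGE_zero (x : ExteriorAlgebra ℂ M) : x ∈ degreeGE M 0 := by
  rw [degreeGE, pow_zero, one_mul]; trivial

theorem ι_mul_mem_degreeGE_one (m : M) (x : ExteriorAlgebra ℂ M) :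
    ExteriorAlgebra.ι ℂ m * x ∈ degreeGE M 1 := by
  rw [degreeGE, pow_one]
  exact Submodule.mul_mem_mul ⟨m, rfl⟩ Submodule.mem_top

/-- The power of the range of `ι` is an exterior power beyond the dimension of M, and its dimension
is a vanishing binomial coefficient. -/
theorem degreeGE_eq_bot [FiniteDimensional ℂ M] :
    degreeGE M (Module.finrank ℂ M + 1) = ⊥ := by
  have h : Module.finrank ℂ (⋀[ℂ]^(Module.finrank ℂ M + 1) M) = 0 := by
    rw [exteriorPower.finrank_eq, Nat.choose_succ_self]
  have h' : ⋀[ℂ]^(Module.finrank ℂ M + 1) M = ⊥ := Submodule.finrank_eq_zero.1 h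
  rw [degreeGE]
  exact (congrArg (· * ⊤) h').trans (Submodule.bot_mul _)

end Nilpotent

/-! ### Exponential of a scalar plus a nilpotent operator. -/

section Exponential

variable {n : ℕ} {κ : Type*} [Fintype κ] [DecidableEq κ]

theorem matrix_exp_eq_sum {J : Type*} [Fintype J] [DecidableEq J] {A : Matrix J J ℂ} {N : ℕ}
    (hA : A ^ N = 0) :
    NormedSpace.exp A = ∑ j ∈ Finset.range N, ((j.factorial : ℂ)⁻¹) • A ^ j := by
  rw [NormedSpace.exp_eq_tsum ℂ]
  refine tsum_eq_sum fun j hj => ?_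
  rw [Finset.mem_range, not_lt] at hj
  rw [pow_eq_zero_of_le hj hA, smul_zero]

/-- The scalar commutes with A, so the exponentials multiply, and the series of A is finite. -/
theorem matrix_exp_smul_one_add {J : Type*} [Fintype J] [DecidableEq J] {A : Matrix J J ℂ} {N : ℕ}
    (hA : A ^ N = 0) (a : ℂ) :
    NormedSpace.exp (a • 1 + A) =
      Complex.exp a • ∑ j ∈ Finset.range N, ((j.factorial : ℂ)⁻¹) • A ^ j := by
  rw [Matrix.exp_add_of_commute _ _ ((Commute.one_left _).smul_left a), matrix_exp_eq_sum hA,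
    Matrix.smul_one_eq_diagonal, Matrix.exp_diagonal]
  have : (NormedSpace.exp fun _ : J => a) = fun _ => Complex.exp a := by
    ext i
    rw [Pi.coe_exp, Complex.exp_eq_exp_ℂ]
  rw [this, ← Matrix.smul_one_eq_diagonal, smul_mul_assoc, one_mul]

theorem expEnd_smul_one_add (T : (κ → Forms n) →ₗ[ℂ] (κ → Forms n)) {N : ℕ} (hT : T ^ N = 0)
    (a : ℂ) : expEnd (a • 1 + T) =
      Complex.exp a • ∑ j ∈ Finset.range N, ((j.factorial : ℂ)⁻¹) • T ^ j := by
  let b := Pi.basis (fun _ : κ => formsBasis n)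
  have hpow : ∀ j, LinearMap.toMatrix b b (T ^ j) = LinearMap.toMatrix b b T ^ j := fun j =>
    map_pow (LinearMap.toMatrixAlgEquiv b) T j
  have hN : LinearMap.toMatrix b b T ^ N = 0 := by rw [← hpow, hT, map_zero]
  change Matrix.toLin b b (NormedSpace.exp (LinearMap.toMatrix b b (a • 1 + T))) = _
  rw [map_add, map_smul, LinearMap.toMatrix_one, matrix_exp_smul_one_add hN, map_smul, map_sum]
  simp only [map_smul, ← hpow, Matrix.toLin_toMatrix]

/-- The endomorphism of `∧ T^* ⊗ E` given by a matrix of forms. -/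
def formOp (A : Matrix κ κ (Forms n)) : (κ → Forms n) →ₗ[ℂ] (κ → Forms n) :=
  LinearMap.pi fun a => ∑ b, (LinearMap.mulRight ℂ (A a b)) ∘ₗ LinearMap.proj b

theorem formOp_apply (A : Matrix κ κ (Forms n)) (ω : κ → Forms n) (a : κ) :
    formOp A ω a = ∑ b, ω b * A a b := by
  simp [formOp]

/-- Each application raises the form degree by at least one, and no forms exist above the top
degree. -/
theorem formOp_pow_eq_zero {A : Matrix κ κ (Forms n)}
    (hA : ∀ a b, A a b ∈ degreeGE (Cotangent n) 1) :
    formOp A ^ (Module.finrank ℂ (Cotangent n) + 1) = 0 := by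
  have h : ∀ j ω a, (formOp A ^ j) ω a ∈ degreeGE (Cotangent n) j := by
    intro j
    induction j with
    | zero => exact fun _ _ => mem_degreeGE_zero _
    | succ j ih =>
      intro ω a
      rw [pow_succ', Module.End.mul_apply, formOp_apply]
      exact Submodule.sum_mem _ fun b _ => mul_mem_degreeGE (ih ω b) (hA a b)
  refine LinearMap.ext fun ω => funext fun a => ?_
  have := h (Module.finrank ℂ (Cotangent n) + 1) ω a
  rwa [degreeGE_eq_bot, Submodule.mem_bot] at this

/-- The supertrace as a linear map. -/
def supertraceLinear (deg : κ → ℕ) :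
    ((κ → Forms n) →ₗ[ℂ] (κ → Forms n)) →ₗ[ℂ] Forms n where
  toFun := supertrace deg
  map_add' S T := by simp [supertrace, Finset.sum_add_distrib]
  map_smul' a T := by simp [supertrace, Finset.smul_sum, smul_comm a]

instance : FiniteDimensional ℂ (Forms n) := Module.Finite.of_basis (formsBasis n)

/-- The supertrace of the exponential of a form-linear endomorphism that is a scalar in form
degree `0`. -/
theorem supertrace_expEnd_formOp {W : Type*} (S : Subalgebra ℂ (W → ℂ)) (deg : κ → ℕ)
    (a : W → ℂ) (A : W → Matrix κ κ (Forms n))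
    (hA : ∀ w i j, A w i j ∈ degreeGE (Cotangent n) 1)
    (hS : ∀ i j, CoordMem S (fun w => A w i j)) :
    ∃ P : W → Forms n, CoordMem S P ∧
      ∀ w, supertrace deg (expEnd (a w • 1 + formOp (A w))) = Complex.exp (a w) • P w := by
  refine ⟨fun w => supertraceLinear deg (∑ j ∈ Finset.range (Module.finrank ℂ (Cotangent n) + 1),
    ((j.factorial : ℂ)⁻¹) • formOp (A w) ^ j), ?_, fun w => ?_⟩
  · have hop : CoordMem S (fun w => formOp (A w)) := by
      -- `L i j ω` right-multiplies the j-th coordinate by ω and puts the result in slot i; this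
      -- exhibits `formOp` as linear in the entries.
      let L : (i j : κ) → Forms n →ₗ[ℂ] (κ → Forms n) →ₗ[ℂ] (κ → Forms n) := fun i j =>
        (LinearMap.llcomp ℂ _ _ _ (LinearMap.single ℂ (fun _ : κ => Forms n) i)) ∘ₗ
          (LinearMap.lcomp ℂ _ (LinearMap.proj j)) ∘ₗ (LinearMap.mul ℂ (Forms n)).flip
      have := CoordMem.sum (s := Finset.univ) (fun i _ => CoordMem.sum (s := Finset.univ)
        (fun j _ => (hS i j).map (L i j)))
      convert this using 1
      funext w
      refine LinearMap.ext fun ω => funext fun i => ?_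
      simp [L, formOp_apply, Finset.sum_apply, Pi.single_apply]
    exact (CoordMem.sum fun j _ => (hop.pow j).const_smul _).map _
  · rw [expEnd_smul_one_add _ (formOp_pow_eq_zero (hA w))]
    exact (supertraceLinear deg).map_smul _ _

end Exponential

/-! ### Curvature of a superconnection whose odd part has scalar square. -/

section Curvature

variable {n : ℕ} {κ : Type*} [Fintype κ] [DecidableEq κ]

theorem extD_const (α : Forms n) (x : Fin n → ℂ) : extD (fun _ => α) x = 0 := by
  simp [extD, coordDeriv]

theorem extD_mem_degreeGE (α : (Fin n → ℂ) → Forms n) (x : Fin n → ℂ) :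
    extD α x ∈ degreeGE (Cotangent n) 1 :=
  Submodule.sum_mem _ fun _ _ =>
    Submodule.add_mem _ (ι_mul_mem_degreeGE_one _ _) (ι_mul_mem_degreeGE_one _ _)

theorem superconnection_frame (G u : (Fin n → ℂ) → Matrix κ κ ℂ) (b : κ) (x : Fin n → ℂ) (a : κ) :
    superconnection G u (fun _ => Pi.single b 1) x a =
      ExteriorAlgebra.ι ℂ (chernMatrix G x a b) + u x a b • 1 := by
  have h : ∀ c : κ, (Pi.single b 1 : κ → Forms n) c = if c = b then 1 else 0 := fun c => by
    rw [Pi.single_apply]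
  simp [superconnection, extD_const, h, apply_ite]

/-- The part of positive form degree of the curvature of a superconnection. -/
def curvaturePart (G u : (Fin n → ℂ) → Matrix κ κ ℂ) (x : Fin n → ℂ) : Matrix κ κ (Forms n) :=
  fun a b =>
    extD (fun y => ExteriorAlgebra.ι ℂ (chernMatrix G y a b) + u y a b • 1) x +
      ∑ c, ExteriorAlgebra.ι ℂ (chernMatrix G x a c) *
        (ExteriorAlgebra.ι ℂ (chernMatrix G x c b) + u x c b • 1) -
      ∑ c, u x a c • ExteriorAlgebra.ι ℂ (chernMatrix G x c b)

theorem curvaturePart_mem_degreeGE (G u : (Fin n → ℂ) → Matrix κ κ ℂ) (x : Fin n → ℂ) (a b : κ) :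
    curvaturePart G u x a b ∈ degreeGE (Cotangent n) 1 := by
  refine Submodule.sub_mem _ (Submodule.add_mem _ (extD_mem_degreeGE _ _)
    (Submodule.sum_mem _ fun _ _ => ι_mul_mem_degreeGE_one _ _))
    (Submodule.sum_mem _ fun c _ => Submodule.smul_mem _ _ ?_)
  simpa using ι_mul_mem_degreeGE_one (chernMatrix G x c b) 1

/-- In D² e_j every term other than u² contains an exterior derivative or a connection form. The
minus sign in `curvaturePart` is the Koszul sign of u passing a one-form. -/
theorem curvature_superconnection (G u : (Fin n → ℂ) → Matrix κ κ ℂ) (x : Fin n → ℂ) {a : ℂ}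
    (h : u x * u x = a • 1) :
    curvature (superconnection G u) x = a • 1 + formOp (curvaturePart G u x) := by
  have key : ∀ i j, superconnection G u (superconnection G u (fun _ => Pi.single j 1)) x i =
      algebraMap ℂ (Forms n) ((u x * u x) i j) + curvaturePart G u x i j := by
    intro i j
    rw [superconnection]
    simp only [superconnection_frame, curvaturePart, map_add, map_smul, map_one,
      CliffordAlgebra.involute_ι, smul_add, Finset.sum_add_distrib, Matrix.mul_apply]
    have h1 : ∑ c, u x i c • u x c j • (1 : Forms n) =
        algebraMap ℂ (Forms n) (∑ c, u x i c * u x c j) := by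
      rw [map_sum]
      exact Finset.sum_congr rfl fun c _ => by rw [smul_smul, Algebra.algebraMap_eq_smul_one]
    have h2 : ∑ c, u x i c • -(CliffordAlgebra.ι (0 : QuadraticForm ℂ (Cotangent n))
          (chernMatrix G x c j)) =
        -∑ c, u x i c • ExteriorAlgebra.ι ℂ (chernMatrix G x c j) := by
      rw [← Finset.sum_neg_distrib]
      exact Finset.sum_congr rfl fun c _ => smul_neg _ _
    rw [h1, h2]
    abel
  refine LinearMap.ext fun ω => funext fun i => ?_
  simp only [curvature, LinearMap.pi_apply, LinearMap.sum_apply, LinearMap.comp_apply,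
    LinearMap.mulRight_apply, LinearMap.proj_apply, key, h, LinearMap.add_apply,
    LinearMap.smul_apply, Module.End.one_apply, Pi.add_apply, formOp_apply, mul_add,
    Finset.sum_add_distrib, Pi.smul_apply]
  congr 1
  rw [Finset.sum_eq_single i]
  · rw [Matrix.smul_apply, Matrix.one_apply_eq, smul_eq_mul, mul_one, Algebra.smul_def,
      Algebra.commutes]
  · intro j _ hj
    rw [Matrix.smul_apply, Matrix.one_apply_ne hj.symm, smul_zero, map_zero, mul_zero]
  · simp

/-- All terms are affine in w. For the exterior derivative this rests on differentiability of u at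
x, which makes the derivative additive in w. -/
theorem curvaturePart_coordMem {W : Type*} [NormedAddCommGroup W] [NormedSpace ℝ W]
    [FiniteDimensional ℝ W] (G : (Fin n → ℂ) → Matrix κ κ ℂ)
    (u : (Fin n → ℂ) → W →ₗ[ℝ] Matrix κ κ ℂ) (x : Fin n → ℂ)
    (hu : ∀ w a b, DifferentiableAt ℝ (fun y => u y w a b) x) (a b : κ) :
    CoordMem (temperateGrowth W) (fun w => curvaturePart G (fun y => u y w) x a b) := by
  have hlin : ∀ c d, (fun w => u x w c d) ∈ temperateGrowth W := fun c d =>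
    temperateGrowth_of_linear (LinearMap.mk (AddHom.mk (fun w => u x w c d) (by simp)) (by simp))
  have hext : CoordMem (temperateGrowth W) (fun w => extD (fun y =>
      ExteriorAlgebra.ι ℂ (chernMatrix G y a b) + u y w a b • 1) x) := by
    have hco : ∀ t, CoordMem (temperateGrowth W) (fun w => coordDeriv (formsBasis n) (fun y =>
        ExteriorAlgebra.ι ℂ (chernMatrix G y a b) + u y w a b • 1) x t) := by
      intro t
      refine CoordMem.sum fun i _ => CoordMem.smul ?_ (CoordMem.const _)
      let g : (Fin n → ℂ) → W →ₗ[ℝ] ℂ := fun y =>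
        { toFun := fun w => u y w a b * (formsBasis n).repr 1 i
          map_add' := by simp [add_mul]
          map_smul' := by simp [mul_assoc] }
      have := fderiv_add_linear_temperateGrowth
        (fun y => (formsBasis n).repr (ExteriorAlgebra.ι ℂ (chernMatrix G y a b)) i) g x t
        (fun w => (hu w a b).mul_const _)
      simpa [g] using this
    exact CoordMem.sum fun j _ =>
      ((CoordMem.const _).mul (hco _)).add ((CoordMem.const _).mul (hco _))
  exact (hext.add (CoordMem.sum fun c _ => (CoordMem.const _).mul
    ((CoordMem.const _).add ((hlin c b |> CoordMem.smul) (CoordMem.const _))))).sub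
    (CoordMem.sum fun c _ => CoordMem.smul (hlin a c) (CoordMem.const _))

/-- The supertrace of the exponential of the curvature of a superconnection whose odd part depends
linearly on a parameter and has scalar square. -/
theorem supertrace_expEnd_curvature {W : Type*} [NormedAddCommGroup W] [NormedSpace ℝ W]
    [FiniteDimensional ℝ W] (deg : κ → ℕ) (G : (Fin n → ℂ) → Matrix κ κ ℂ)
    (u : (Fin n → ℂ) → W →ₗ[ℝ] Matrix κ κ ℂ) (x : Fin n → ℂ)
    (hu : ∀ w a b, DifferentiableAt ℝ (fun y => u y w a b) x) (a : W → ℂ)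
    (hsq : ∀ w, u x w * u x w = a w • 1) :
    ∃ P : W → Forms n, CoordMem (temperateGrowth W) P ∧
      ∀ w, supertrace deg (expEnd (curvature (superconnection G (fun y => u y w)) x)) =
        Complex.exp (a w) • P w := by
  simp only [fun w => curvature_superconnection G (fun y => u y w) x (hsq w)]
  exact supertrace_expEnd_formOp _ deg a _ (fun w => curvaturePart_mem_degreeGE _ _ _)
    (curvaturePart_coordMem G u x hu)

end Curvature

/-! ### Complex conjugation and the extended bilinear forms. -/

section Conjugation

variable {V : Type*} [AddCommGroup V] [Module ℚ V]

theorem conjC_conjC (x : ComplexPts V) : conjC (conjC x) = x := by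
  induction x using TensorProduct.induction_on with
  | zero => simp
  | tmul a v => simp [conjC]
  | add x y hx hy => rw [map_add, map_add, hx, hy]

theorem conjC_realToComplex (v : RealPts V) : conjC (realToComplex v) = realToComplex v := by
  induction v using TensorProduct.induction_on with
  | zero => simp
  | tmul a v => simp [conjC, realToComplex]
  | add x y hx hy => rw [map_add, map_add, hx, hy]

theorem realToComplex_smul (a : ℝ) (v : RealPts V) :
    realToComplex (a • v) = (a : ℂ) • realToComplex v := by
  induction v using TensorProduct.induction_on with
  | zero => simp
  | tmul b v => simp [realToComplex, TensorProduct.smul_tmul']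
  | add x y hx hy => rw [smul_add, map_add, map_add, hx, hy, smul_add]

theorem realToComplex_injective : Function.Injective (realToComplex (V := V)) :=
  Module.Flat.rTensor_preserves_injective_linearMap _ Complex.ofReal_injective

theorem complexForm_conjC (Q : LinearMap.BilinForm ℚ V) (x y : ComplexPts V) :
    complexForm Q (conjC x) (conjC y) = starRingEnd ℂ (complexForm Q x y) := by
  induction x using TensorProduct.induction_on with
  | zero => simp
  | add x x' hx hx' => simp only [map_add, LinearMap.add_apply, hx, hx']
  | tmul a v =>
    induction y using TensorProduct.induction_on with
    | zero => simp
    | add y y' hy hy' => simp only [map_add, hy, hy']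
    | tmul b w =>
      simp only [conjC, LinearMap.coe_mk, AddHom.coe_mk, LinearMap.rTensor_tmul,
        LinearMap.BilinForm.baseChange_tmul]
      simp [Rat.smul_def]

theorem complexForm_realToComplex (Q : LinearMap.BilinForm ℚ V) (x y : RealPts V) :
    complexForm Q (realToComplex x) (realToComplex y) = (realForm Q x y : ℂ) := by
  induction x using TensorProduct.induction_on with
  | zero => simp
  | add x x' hx hx' => simp only [map_add, LinearMap.add_apply, hx, hx', Complex.ofReal_add]
  | tmul a v =>
    induction y using TensorProduct.induction_on with
    | zero => simp
    | add y y' hy hy' => simp only [map_add, hy, hy', Complex.ofReal_add]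
    | tmul b w => simp [realToComplex]

theorem complexForm_symm {Q : LinearMap.BilinForm ℚ V} (hQ : Q.IsSymm) (x y : ComplexPts V) :
    complexForm Q x y = complexForm Q y x := by
  induction x using TensorProduct.induction_on with
  | zero => simp
  | add x x' hx hx' => simp only [map_add, LinearMap.add_apply, hx, hx']
  | tmul a v =>
    induction y using TensorProduct.induction_on with
    | zero => simp
    | add y y' hy hy' => simp only [map_add, LinearMap.add_apply, hy, hy']
    | tmul b w => simp [hQ.eq v w, mul_comm]

/-- The complex conjugate of an endomorphism of the complex points. -/
def conjEnd (A : Module.End ℂ (ComplexPts V)) : Module.End ℂ (ComplexPts V) where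
  toFun x := conjC (A (conjC x))
  map_add' x y := by simp only [map_add]
  map_smul' a x := by simp

theorem conjEnd_apply (A : Module.End ℂ (ComplexPts V)) (x : ComplexPts V) :
    conjEnd A x = conjC (A (conjC x)) := rfl

end Conjugation

/-! ### Operators diagonal in the Hodge decomposition and projections onto the filtration. -/

namespace HodgeStructure

variable {V : Type*} [AddCommGroup V] [Module ℚ V] {w : ℕ} (S : HodgeStructure V w)

/-- The operator acting on `V^{p,w-p}` as multiplication by `ε p`. -/
def diag (ε : Fin (w + 1) → ℂ) : ComplexPts V →ₗ[ℂ] ComplexPts V :=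
  DirectSum.toModule ℂ (Fin (w + 1)) (ComplexPts V) (fun p => ε p • (hodgePiece S.F w p).subtype) ∘ₗ
    (LinearEquiv.ofBijective
      (DirectSum.coeLinearMap (fun p : Fin (w + 1) => hodgePiece S.F w p)) S.isInternal).symm

theorem diag_apply_of_mem (ε : Fin (w + 1) → ℂ) {p : Fin (w + 1)} {x : ComplexPts V}
    (hx : x ∈ hodgePiece S.F w p) : S.diag ε x = ε p • x := by
  have h : (LinearEquiv.ofBijective (DirectSum.coeLinearMap
      (fun p : Fin (w + 1) => hodgePiece S.F w p)) S.isInternal).symm x =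
      DirectSum.lof ℂ (Fin (w + 1)) (fun p => hodgePiece S.F w p) p ⟨x, hx⟩ := by
    rw [LinearEquiv.symm_apply_eq]
    exact (DirectSum.coeLinearMap_lof (fun p : Fin (w + 1) => hodgePiece S.F w p) p ⟨x, hx⟩).symm
  rw [diag, LinearMap.comp_apply, LinearEquiv.coe_coe, h, DirectSum.toModule_lof]
  rfl

theorem piece_induction {P : ComplexPts V → Prop} (x : ComplexPts V)
    (hmem : ∀ p : Fin (w + 1), ∀ x ∈ hodgePiece S.F w p, P x) (h0 : P 0)
    (hadd : ∀ x y, P x → P y → P (x + y)) : P x :=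
  Submodule.iSup_induction (fun p : Fin (w + 1) => hodgePiece S.F w p) (motive := P)
    (by rw [S.isInternal.submodule_iSup_eq_top]; trivial) hmem h0 hadd

theorem ext_pieces {M : Type*} [AddCommGroup M] [Module ℂ M] {A B : ComplexPts V →ₗ[ℂ] M}
    (h : ∀ p : Fin (w + 1), ∀ x ∈ hodgePiece S.F w p, A x = B x) : A = B :=
  LinearMap.ext fun x => S.piece_induction x h (by simp)
    fun x y hx hy => by rw [map_add, map_add, hx, hy]

theorem diag_one : S.diag (fun _ => 1) = LinearMap.id :=
  S.ext_pieces fun p x hx => by rw [S.diag_apply_of_mem _ hx, one_smul]; rfl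

theorem diag_add (α β : Fin (w + 1) → ℂ) : S.diag α + S.diag β = S.diag (fun p => α p + β p) :=
  S.ext_pieces fun p x hx => by
    simp only [LinearMap.add_apply, S.diag_apply_of_mem _ hx, add_smul]

theorem diag_diag (α β : Fin (w + 1) → ℂ) (x : ComplexPts V) :
    S.diag α (S.diag β x) = S.diag (fun p => α p * β p) x := by
  refine LinearMap.congr_fun (f := S.diag α ∘ₗ S.diag β) (S.ext_pieces fun p x hx => ?_) x
  rw [LinearMap.comp_apply, S.diag_apply_of_mem β hx, map_smul, S.diag_apply_of_mem _ hx,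
    S.diag_apply_of_mem _ hx, smul_smul, mul_comm]

theorem diag_mem {N : Submodule ℂ (ComplexPts V)} {ε : Fin (w + 1) → ℂ}
    (h : ∀ p, ε p ≠ 0 → hodgePiece S.F w p ≤ N) (x : ComplexPts V) : S.diag ε x ∈ N := by
  refine S.piece_induction (P := fun x => S.diag ε x ∈ N) x (fun p x hx => ?_) (by simp)
    fun x y hx hy => by rw [map_add]; exact N.add_mem hx hy
  rw [S.diag_apply_of_mem _ hx]
  by_cases hε : ε p = 0
  · simp [hε]
  · exact N.smul_mem _ (h p hε hx)

/-- The projection onto `V^{p,w-p}`. -/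
def component (p : Fin (w + 1)) : ComplexPts V →ₗ[ℂ] ComplexPts V :=
  S.diag (fun q => if q = p then 1 else 0)

theorem component_mem (p : Fin (w + 1)) (x : ComplexPts V) :
    S.component p x ∈ hodgePiece S.F w p :=
  S.diag_mem (fun q hq => by
    by_cases h : q = p
    · rw [h]
    · simp [h] at hq) x

theorem sum_component (x : ComplexPts V) : ∑ p, S.component p x = x := by
  refine S.piece_induction (P := fun x => ∑ p, S.component p x = x) x (fun p x hx => ?_) (by simp)
    fun x y hx hy => by simp only [map_add, Finset.sum_add_distrib, hx, hy]
  simp [component, S.diag_apply_of_mem _ hx]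

theorem diag_eq_sum (ε : Fin (w + 1) → ℂ) (x : ComplexPts V) :
    S.diag ε x = ∑ p, ε p • S.component p x := by
  conv_lhs => rw [← S.sum_component x, map_sum]
  exact Finset.sum_congr rfl fun p _ => S.diag_apply_of_mem _ (S.component_mem p x)

theorem conjC_mem_hodgePiece {p : Fin (w + 1)} {x : ComplexPts V}
    (hx : x ∈ hodgePiece S.F w p) : conjC x ∈ hodgePiece S.F w (Fin.rev p) := by
  have hp : w - (w - (p : ℕ)) = p := by omega
  refine ⟨?_, ?_⟩
  · rw [Fin.val_rev, Nat.add_sub_add_right]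
    exact hx.2
  · change conjC (conjC x) ∈ S.F (w - (Fin.rev p : ℕ))
    rw [conjC_conjC, Fin.val_rev, Nat.add_sub_add_right, hp]
    exact hx.1

theorem conjC_diag (ε : Fin (w + 1) → ℂ) (x : ComplexPts V) :
    conjC (S.diag ε x) = S.diag (fun p => starRingEnd ℂ (ε (Fin.rev p))) (conjC x) := by
  refine S.piece_induction (P := fun x => conjC (S.diag ε x) =
    S.diag (fun p => starRingEnd ℂ (ε (Fin.rev p))) (conjC x)) x (fun p x hx => ?_) (by simp)
    fun x y hx hy => by rw [map_add, map_add, map_add, map_add, hx, hy]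
  rw [S.diag_apply_of_mem _ hx, S.diag_apply_of_mem _ (S.conjC_mem_hodgePiece hx), Fin.rev_rev,
    LinearMap.map_smulₛₗ]

/-- The projection onto `F^p` along the conjugate of `F^{w-p+1}`. -/
def proj (p : ℕ) : ComplexPts V →ₗ[ℂ] ComplexPts V :=
  S.diag (fun q => if p ≤ q then 1 else 0)

theorem proj_mem (p : ℕ) (x : ComplexPts V) : S.proj p x ∈ S.F p :=
  S.diag_mem (fun q hq => by
    by_cases h : p ≤ q
    · exact inf_le_left.trans (S.antitone h)
    · simp [h] at hq) x

/-- For p < w such an x also lies in V^{p+1,w-p-1}, because F^{w-p} ⊆ F^{w-p-1}; the projection onto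
V^{p,w-p} then both fixes and kills it. For p = w use F^{w+1} = 0. -/
theorem disjoint_F_succ {p : Fin (w + 1)} {x : ComplexPts V} (hx : x ∈ hodgePiece S.F w p)
    (hx' : x ∈ S.F (p + 1)) : x = 0 := by
  rcases Nat.lt_or_ge (p : ℕ) w with hp | hp
  · have hmem : x ∈ hodgePiece S.F w (⟨p + 1, by omega⟩ : Fin (w + 1)) :=
      ⟨hx', S.antitone (by simp only; omega) hx.2⟩
    have h1 := S.diag_apply_of_mem (fun q => if q = p then 1 else 0) hx
    have h2 := S.diag_apply_of_mem (fun q => if q = p then 1 else 0) hmem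
    rw [h1] at h2
    simpa [Fin.ext_iff] using h2
  · have : (p : ℕ) + 1 = w + 1 := by omega
    rwa [this, S.F_top, Submodule.mem_bot] at hx'

/-- This is F^p = ⨁_{q ≥ p} V^{q,w-q}. Components of x below p vanish one at a time from the lowest:
once those below a are gone, the a-th is x minus an element of F^{a+1}, so it lies in F^{a+1} and is
zero by `disjoint_F_succ`. -/
theorem proj_apply_of_mem_of_le {p : ℕ} (hp : p ≤ w + 1) {x : ComplexPts V} (hx : x ∈ S.F p)
    {a : ℕ} (ha : a ≤ p) : S.proj a x = x := by
  induction a with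
  | zero => simp [proj, diag_one]
  | succ a ih =>
    have h := ih (by omega)
    let q : Fin (w + 1) := ⟨a, by omega⟩
    have hsplit : S.proj a x = S.component q x + S.proj (a + 1) x := by
      rw [proj, proj, component, ← LinearMap.add_apply, diag_add]
      congr 2
      funext p
      have : p = q ↔ (p : ℕ) = a := Fin.ext_iff
      rcases lt_trichotomy (p : ℕ) a with h | h | h
      · simp [this, h.ne, show ¬ a ≤ (p : ℕ) by omega, show ¬ a + 1 ≤ (p : ℕ) by omega]
      · simp [this, h]
      · simp [this, h.ne', show a ≤ (p : ℕ) by omega, show a + 1 ≤ (p : ℕ) by omega]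
    have hc : S.component q x = 0 := by
      refine S.disjoint_F_succ (S.component_mem q x) ?_
      rw [← add_sub_cancel_right (S.component q x) (S.proj (a + 1) x), ← hsplit, h]
      exact Submodule.sub_mem _ (S.antitone ha hx) (S.proj_mem _ _)
    rw [hc, zero_add, h] at hsplit
    exact hsplit.symm

theorem proj_apply_of_mem {p : ℕ} (hp : p ≤ w + 1) {x : ComplexPts V} (hx : x ∈ S.F p) :
    S.proj p x = x :=
  S.proj_apply_of_mem_of_le hp hx le_rfl

/-- Conjugation exchanges q and w - q, and the condition p ≤ w - q is complementary to w + 1 - p ≤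
q. -/
theorem conjC_proj {p : ℕ} (hp : p ≤ w + 1) (x : ComplexPts V) :
    conjC (S.proj p x) = conjC x - S.proj (w + 1 - p) (conjC x) := by
  rw [proj, conjC_diag, eq_sub_iff_add_eq, proj, ← LinearMap.add_apply, diag_add]
  refine Eq.trans ?_ (LinearMap.congr_fun S.diag_one (conjC x))
  congr 2
  funext q
  have h : ((Fin.rev q : Fin (w + 1)) : ℕ) = w - q := by rw [Fin.val_rev]; omega
  have hq := q.isLt
  rw [h]
  by_cases h1 : p ≤ w - (q : ℕ)
  · simp [h1, show ¬ w + 1 - p ≤ (q : ℕ) by omega]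
  · simp [h1, show w + 1 - p ≤ (q : ℕ) by omega]

theorem conjC_sub_proj_mem {p : ℕ} (hp : p ≤ w + 1) (x : ComplexPts V) :
    conjC (x - S.proj p x) ∈ S.F (w + 1 - p) := by
  rw [map_sub, S.conjC_proj hp, sub_sub_cancel]
  exact S.proj_mem _ _

theorem proj_apply_of_conjC_mem {p : ℕ} (hp : p ≤ w + 1) {x : ComplexPts V}
    (hx : conjC x ∈ S.F (w + 1 - p)) : S.proj p x = 0 := by
  have h := S.conjC_proj hp x
  rw [S.proj_apply_of_mem (by omega) hx, sub_self] at h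
  rw [← conjC_conjC (S.proj p x), h, map_zero]

theorem weil_eq_diag :
    S.weil = S.diag (fun p => Complex.I ^ ((p : ℤ) - ((w : ℤ) - (p : ℤ)))) := rfl

/-- Differences of consecutive filtration projections are the component projections. With constant
coefficients, regularity of the Weil operator follows from that of the `proj p`. -/
theorem diag_eq_sum_proj (ε : Fin (w + 1) → ℂ) :
    S.diag ε = ∑ p : Fin (w + 1), ε p • (S.proj p - S.proj (p + 1)) := by
  refine S.ext_pieces fun q x hx => ?_
  have h : ∀ p : Fin (w + 1), ((ε p • (S.proj p - S.proj (p + 1)) : _ →ₗ[ℂ] _) x) =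
      if p = q then ε q • x else 0 := by
    intro p
    rw [LinearMap.smul_apply, LinearMap.sub_apply, proj, proj, S.diag_apply_of_mem _ hx,
      S.diag_apply_of_mem _ hx]
    have : p = q ↔ (p : ℕ) = q := Fin.ext_iff
    rcases lt_trichotomy (p : ℕ) q with h | h | h
    · simp [this, h.ne, show (p : ℕ) ≤ q by omega, show (p : ℕ) + 1 ≤ q by omega]
    · have := Fin.ext h
      subst this
      simp
    · simp [this, h.ne', show ¬ (p : ℕ) ≤ q by omega, show ¬ (p : ℕ) + 1 ≤ q by omega]
  rw [LinearMap.sum_apply, Finset.sum_congr rfl fun p _ => h p, S.diag_apply_of_mem _ hx]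
  simp

end HodgeStructure

/-! ### The dual of a hermitian metric. -/

section PositiveMatrix

open scoped ComplexOrder

variable {J : Type*} [Fintype J] [DecidableEq J]

/-- A quantitative form of the Cauchy-Schwarz inequality for the dual metric. -/
theorem dual_norm_bound {G : Matrix J J ℂ} (hG : G.PosDef) (s ξ : J → ℂ) :
    (s ⬝ᵥ G⁻¹.mulVec (star s)).im = 0 ∧
      4 * (s ⬝ᵥ ξ).re - 4 * (star ξ ⬝ᵥ G.mulVec ξ).re ≤ (s ⬝ᵥ G⁻¹.mulVec (star s)).re := by
  have hd := (Matrix.isUnit_iff_isUnit_det _).1 hG.isUnit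
  have hsemi : ∀ x : J → ℂ, 0 ≤ star x ⬝ᵥ G.mulVec x := fun x =>
    hG.posSemidef.dotProduct_mulVec_nonneg x
  have hinv := hG.inv.posSemidef.dotProduct_mulVec_nonneg (star s)
  rw [star_star] at hinv
  refine ⟨(Complex.nonneg_iff.1 hinv).2.symm, ?_⟩
  -- η is the vector dual to s, so its squared length is that of s.
  set η := G⁻¹.mulVec (star s) with hη
  have hGη : G.mulVec η = star s := by
    rw [hη, Matrix.mulVec_mulVec, Matrix.mul_nonsing_inv _ hd, Matrix.one_mulVec]
  have h1 : star ξ ⬝ᵥ G.mulVec η = star (s ⬝ᵥ ξ) := by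
    rw [hGη, Matrix.star_dotProduct_star, dotProduct_comm]
  have h2 : star η ⬝ᵥ G.mulVec η = star (s ⬝ᵥ η) := by
    rw [hGη, Matrix.star_dotProduct_star, dotProduct_comm]
  have h3 : star η ⬝ᵥ G.mulVec ξ = s ⬝ᵥ ξ := by
    have h4 := congrArg star hGη
    rw [Matrix.star_mulVec, hG.isHermitian.eq, star_star] at h4
    rw [Matrix.dotProduct_mulVec, h4]
  -- The multiple 2 of ξ is the optimal one when s(ξ) is twice the squared length of ξ, as for the
  -- vector of `exists_majorant` in the metric with its factor 1/2.
  have h := (Complex.nonneg_iff.1 (hsemi (η - (2 : ℂ) • ξ))).1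
  have hexp : star (η - (2 : ℂ) • ξ) ⬝ᵥ G.mulVec (η - (2 : ℂ) • ξ) =
      star (s ⬝ᵥ η) - 2 * (s ⬝ᵥ ξ) - 2 * star (s ⬝ᵥ ξ) + 4 * (star ξ ⬝ᵥ G.mulVec ξ) := by
    rw [star_sub, star_smul, Matrix.mulVec_sub, Matrix.mulVec_smul, sub_dotProduct,
      dotProduct_sub, dotProduct_sub, dotProduct_smul, dotProduct_smul, smul_dotProduct,
      smul_dotProduct, h1, h2, h3]
    simp only [smul_eq_mul, RCLike.star_def, map_ofNat]
    ring
  rw [hexp] at h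
  simp at h
  linarith

end PositiveMatrix

/-! ### Polarization and the majorant inequality. -/

namespace PeriodDomain

open scoped ComplexOrder

variable {V : Type*} [AddCommGroup V] [Module ℚ V] {Q : LinearMap.BilinForm ℚ V} {k : ℕ}
  {h : Fin (2 * k + 1) → ℕ} (z : PeriodDomain Q k h)

/-- The sign by which the Weil operator acts on `V^{p,2k-p}`. -/
def weilSign (k : ℕ) (p : Fin (2 * k + 1)) : ℝ := (-1) ^ ((p : ℕ) + k)

theorem weilSign_mul_self (p : Fin (2 * k + 1)) : weilSign k p * weilSign k p = 1 := by
  rw [weilSign, ← pow_add]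
  exact Even.neg_one_pow ⟨_, rfl⟩

theorem weil_eq : z.weil = z.diag (fun p => (weilSign k p : ℂ)) := by
  rw [HodgeStructure.weil_eq_diag]
  congr 1
  funext p
  have h1 : ((p : ℤ) - (((2 * k : ℕ) : ℤ) - (p : ℤ))) = 2 * ((p : ℤ) - k) := by push_cast; ring
  have h2 : (p : ℤ) - k = ((p : ℕ) + k : ℕ) - (2 * k : ℤ) := by push_cast; ring
  rw [h1, zpow_mul, zpow_ofNat, Complex.I_sq, h2, zpow_sub₀ (by norm_num), zpow_mul,
    zpow_natCast]
  simp [weilSign]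

/-- If a > b, then conj y ∈ F^{2k-b} ⊆ F^{2k+1-a} and the first bilinear relation applies; if a < b,
it applies to conj x and y. -/
theorem orthogonal {a b : Fin (2 * k + 1)} (hab : a ≠ b) {x y : ComplexPts V}
    (hx : x ∈ hodgePiece z.F (2 * k) a) (hy : y ∈ hodgePiece z.F (2 * k) b) :
    complexForm Q x (conjC y) = 0 := by
  have ha := a.isLt
  have hb := b.isLt
  rcases lt_or_gt_of_ne (fun h => hab (Fin.ext h) : (a : ℕ) ≠ b) with hlt | hlt
  · have h1 : conjC x ∈ z.F (2 * k - a) := hx.2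
    have h2 : y ∈ z.F (2 * k + 1 - (2 * k - a)) := z.antitone (by omega) hy.1
    have h3 := z.riemann_orthogonal _ (by omega) _ h1 _ h2
    have h4 := complexForm_conjC Q (conjC x) y
    rwa [conjC_conjC, h3, map_zero] at h4
  · exact z.riemann_orthogonal a (by omega) x hx.1 _ (z.antitone (by omega) hy.2)

theorem form_diag (α β : Fin (2 * k + 1) → ℂ) (x y : ComplexPts V) :
    complexForm Q (z.diag α x) (conjC (z.diag β y)) =
      ∑ a, α a * starRingEnd ℂ (β a) *
        complexForm Q (z.component a x) (conjC (z.component a y)) := by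
  rw [z.diag_eq_sum α, z.diag_eq_sum β]
  simp only [map_sum, map_smul, LinearMap.sum_apply, LinearMap.smul_apply, LinearMap.map_smulₛₗ]
  refine Finset.sum_congr rfl fun a _ => ?_
  rw [Finset.sum_eq_single a]
  · simp only [smul_eq_mul]; ring
  · intro b _ hb
    rw [z.orthogonal hb (z.component_mem b x) (z.component_mem a y)]
    simp
  · simp

/-- The hermitian form `Q (C x, conj y)`. -/
def hodgeForm (x y : ComplexPts V) : ℂ := complexForm Q (z.weil x) (conjC y)

theorem hodgeForm_eq (x y : ComplexPts V) :
    z.hodgeForm x y = ∑ a, (weilSign k a : ℂ) *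
      complexForm Q (z.component a x) (conjC (z.component a y)) := by
  have := z.form_diag (fun p => (weilSign k p : ℂ)) (fun _ => 1) x y
  rw [z.diag_one] at this
  rw [hodgeForm, weil_eq]
  simpa using this

theorem hodgeForm_conj (hQ : Q.IsSymm) (x y : ComplexPts V) :
    starRingEnd ℂ (z.hodgeForm x y) = z.hodgeForm y x := by
  rw [hodgeForm_eq, hodgeForm_eq, map_sum]
  refine Finset.sum_congr rfl fun a _ => ?_
  rw [map_mul, Complex.conj_ofReal, ← complexForm_conjC, conjC_conjC, complexForm_symm hQ]

theorem hodgeForm_self_pos {x : ComplexPts V} (hx : x ≠ 0) : 0 < z.hodgeForm x x :=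
  z.riemann_positive x hx

/-- C acts on one piece by a sign, so positivity of Q(Cx, conj x) fixes the sign of Q(x, conj x); N
is the Hodge norm of the component. -/
theorem exists_component_norm (x : ComplexPts V) (a : Fin (2 * k + 1)) :
    ∃ N : ℝ, 0 ≤ N ∧
      complexForm Q (z.component a x) (conjC (z.component a x)) = (weilSign k a * N : ℝ) := by
  have hnn : 0 ≤ z.hodgeForm (z.component a x) (z.component a x) := by
    by_cases h : z.component a x = 0
    · simp [h, hodgeForm]
    · exact (z.hodgeForm_self_pos h).le
  have heq : z.hodgeForm (z.component a x) (z.component a x) = (weilSign k a : ℂ) *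
      complexForm Q (z.component a x) (conjC (z.component a x)) := by
    rw [hodgeForm, weil_eq, z.diag_apply_of_mem _ (z.component_mem a x)]
    simp
  refine ⟨_, (Complex.nonneg_iff.1 hnn).1, ?_⟩
  have him := (Complex.nonneg_iff.1 hnn).2
  have hre : ((z.hodgeForm (z.component a x) (z.component a x)).re : ℂ) =
      z.hodgeForm (z.component a x) (z.component a x) := Complex.ext rfl him
  rw [Complex.ofReal_mul, hre, heq, ← mul_assoc, ← Complex.ofReal_mul, weilSign_mul_self]
  simp

/-- The majorant inequality: with `e = C (v_{>k})`, where `v_{>k}` is the projection of `v` to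
`F^{k+1}`, one has `Q(e, v) = Q(C e, conj e)` and `Q(v, v) + 4 Q(e, v) > 0`. -/
theorem exists_majorant (hQ : Q.IsSymm) (v : RealPts V) :
    ∃ e ∈ z.F (k + 1), ∃ N : ℝ, complexForm Q e (realToComplex v) = N ∧ z.hodgeForm e e = N ∧
      0 ≤ realForm Q v v + 4 * N ∧ (v ≠ 0 → 0 < realForm Q v v + 4 * N) := by
  set x := realToComplex v with hx
  have hxc : conjC x = x := conjC_realToComplex v
  choose n hn0 hn using z.exists_component_norm x
  let δ : Fin (2 * k + 1) → ℝ := fun p => if k + 1 ≤ (p : ℕ) then 1 else 0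
  have hid : ∀ y, z.diag (fun _ => 1) y = y := fun y => by rw [z.diag_one]; rfl
  -- As v is real, conjugation exchanges its components of index a and 2k - a, which carry the same
  -- sign by parity.
  have hsymm : ∀ a, n (Fin.rev a) = n a := by
    intro a
    have hc : z.component (Fin.rev a) x = conjC (z.component a x) := by
      rw [HodgeStructure.component, HodgeStructure.component, z.conjC_diag, hxc]
      congr 2
      funext p
      have : (Fin.rev p = a) ↔ (p = Fin.rev a) := Fin.rev_eq_iff
      simp [this]
    have hs : weilSign k (Fin.rev a) = weilSign k a := by
      have ha := a.isLt
      rw [weilSign, weilSign, Fin.val_rev, neg_one_pow_congr]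
      rw [Nat.even_iff, Nat.even_iff]
      omega
    have h1 := hn (Fin.rev a)
    rw [hc, conjC_conjC, complexForm_symm hQ, hn a, hs] at h1
    have h2 := congrArg (weilSign k a * ·) (Complex.ofReal_injective h1)
    simp only [← mul_assoc, weilSign_mul_self, one_mul] at h2
    exact h2.symm
  have hform : ∀ α β : Fin (2 * k + 1) → ℝ,
      complexForm Q (z.diag (fun p => (α p : ℂ)) x) (conjC (z.diag (fun p => (β p : ℂ)) x)) =
        ((∑ a, α a * β a * (weilSign k a * n a) : ℝ) : ℂ) := by
    intro α β
    rw [z.form_diag, Complex.ofReal_sum]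
    refine Finset.sum_congr rfl fun a _ => ?_
    rw [hn a]
    push_cast
    rw [Complex.conj_ofReal]
  have hvv : realForm Q v v = ∑ a, weilSign k a * n a := by
    have h1 := hform (fun _ => 1) (fun _ => 1)
    simp only [Complex.ofReal_one, hid, hxc, one_mul] at h1
    rw [hx, complexForm_realToComplex] at h1
    exact_mod_cast h1
  have hxx : z.hodgeForm x x = ((∑ a, n a : ℝ) : ℂ) := by
    have h1 := hform (weilSign k) (fun _ => 1)
    simp only [Complex.ofReal_one, hid, mul_one, ← mul_assoc, weilSign_mul_self, one_mul] at h1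
    rw [hodgeForm, weil_eq, h1]
  -- By this symmetry, 4 times the sum over a > k is 2 times the sum over a ≠ k. Off the middle the
  -- coefficient is ±1 + 2 ≥ 1; in the middle it is the sign itself, (-1)^{2k} = 1.
  have hlower : ∑ a, n a ≤ realForm Q v v + 4 * ∑ a, δ a * n a := by
    have hrev : ∑ a, δ a * n a = ∑ a, δ (Fin.rev a) * n a := by
      rw [← Equiv.sum_comp Fin.revPerm]
      exact Finset.sum_congr rfl fun a _ => by rw [Fin.revPerm_apply, hsymm]
    have h4 : 4 * ∑ a, δ a * n a = ∑ a, 2 * (δ a + δ (Fin.rev a)) * n a := by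
      calc 4 * ∑ a, δ a * n a = 2 * ∑ a, δ a * n a + 2 * ∑ a, δ (Fin.rev a) * n a := by
            rw [← hrev]; ring
        _ = _ := by
            rw [Finset.mul_sum, Finset.mul_sum, ← Finset.sum_add_distrib]
            exact Finset.sum_congr rfl fun a _ => by ring
    rw [hvv, h4, ← Finset.sum_add_distrib]
    refine Finset.sum_le_sum fun a _ => ?_
    rw [← add_mul]
    refine le_mul_of_one_le_left (hn0 a) ?_
    have ha := a.isLt
    have hs : -1 ≤ weilSign k a := by
      rcases neg_one_pow_eq_or ℝ ((a : ℕ) + k) with h | h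
      · rw [weilSign, h]; norm_num
      · rw [weilSign, h]
    have hr : ((Fin.rev a : Fin (2 * k + 1)) : ℕ) = 2 * k - a := by rw [Fin.val_rev]; omega
    rcases lt_trichotomy (a : ℕ) k with hk | hk | hk
    · simp only [δ, hr, show ¬ k + 1 ≤ (a : ℕ) by omega, show k + 1 ≤ 2 * k - (a : ℕ) by omega,
        if_true, if_false]
      linarith
    · have : weilSign k a = 1 := by
        rw [weilSign, hk]; exact Even.neg_one_pow ⟨k, rfl⟩
      simp only [δ, hr, show ¬ k + 1 ≤ (a : ℕ) by omega, show ¬ k + 1 ≤ 2 * k - (a : ℕ) by omega,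
        if_false, this]
      norm_num
    · simp only [δ, hr, show k + 1 ≤ (a : ℕ) by omega, show ¬ k + 1 ≤ 2 * k - (a : ℕ) by omega,
        if_true, if_false]
      linarith
  have hδ : ∀ a, δ a * δ a = δ a := fun a => by by_cases h : k + 1 ≤ (a : ℕ) <;> simp only [δ, h, if_true, if_false, mul_one, mul_zero]
  refine ⟨z.diag (fun p => ((weilSign k p * δ p : ℝ) : ℂ)) x, ?_, ∑ a, δ a * n a, ?_, ?_, ?_, ?_⟩
  · refine z.diag_mem (fun q hq => ?_) x
    by_cases hk : k + 1 ≤ (q : ℕ)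
    · exact inf_le_left.trans (z.antitone hk)
    · exact absurd (by simp only [δ, hk, if_false, mul_zero, Complex.ofReal_zero]) hq
  · have h1 := hform (fun p => weilSign k p * δ p) (fun _ => 1)
    simp only [Complex.ofReal_one, hid, hxc] at h1
    rw [h1]
    congr 1
    refine Finset.sum_congr rfl fun a _ => ?_
    linear_combination (δ a * n a) * weilSign_mul_self a
  · have h1 := hform (fun p => weilSign k p * (weilSign k p * δ p)) (fun p => weilSign k p * δ p)
    rw [hodgeForm, weil_eq, z.diag_diag]
    simp only [← Complex.ofReal_mul]
    rw [h1]
    congr 1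
    refine Finset.sum_congr rfl fun a _ => ?_
    linear_combination (δ a * δ a * n a) * (weilSign k a * weilSign k a + 1) * weilSign_mul_self a +
      n a * hδ a
  · exact (Finset.sum_nonneg fun a _ => hn0 a).trans hlower
  · intro hv
    have hx0 : x ≠ 0 := fun h => hv (realToComplex_injective (h.trans (map_zero _).symm))
    have := z.hodgeForm_self_pos hx0
    rw [hxx] at this
    exact (Complex.zero_lt_real.1 this).trans_le hlower

end PeriodDomain

/-! ### Regularity of determinants and inverses by Cramer's rule. -/

section Determinant

variable {X J : Type*} [Fintype J] [DecidableEq J] {S : Subalgebra ℂ (X → ℂ)}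

theorem det_mem {A : X → Matrix J J ℂ} (hA : ∀ i j, (fun x => A x i j) ∈ S) :
    (fun x => (A x).det) ∈ S := by
  have h : (fun x => (A x).det) = ∑ σ : Equiv.Perm J, algebraMap ℂ (X → ℂ) (Equiv.Perm.sign σ : ℤ) *
      ∏ i, fun x => A x (σ i) i := by
    funext x
    simp [Matrix.det_apply']
  rw [h]
  exact S.sum_mem fun σ _ => S.mul_mem (S.algebraMap_mem _) (S.prod_mem fun i _ => hA _ _)

theorem adjugate_mem {A : X → Matrix J J ℂ} (hA : ∀ i j, (fun x => A x i j) ∈ S) (i j : J) :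
    (fun x => (A x).adjugate i j) ∈ S := by
  simp only [Matrix.adjugate_apply]
  refine det_mem fun a b => ?_
  simp only [Matrix.updateRow_apply]
  split_ifs
  · exact S.algebraMap_mem _
  · exact hA a b

theorem differentiableAt_inv_apply {E : Type*} [NormedAddCommGroup E] [NormedSpace ℝ E] {x : E}
    {A : E → Matrix J J ℂ} (hA : ∀ i j, DifferentiableAt ℝ (fun y => A y i j) x)
    (hx : (A x).det ≠ 0) (i j : J) : DifferentiableAt ℝ (fun y => (A y)⁻¹ i j) x := by
  have hdet : DifferentiableAt ℝ (fun y => (A y).det) x :=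
    det_mem (S := differentiableAtPoint x) hA
  have hadj : DifferentiableAt ℝ (fun y => (A y).adjugate i j) x :=
    adjugate_mem (S := differentiableAtPoint x) hA i j
  simp only [Matrix.inv_def, Matrix.smul_apply, Ring.inverse_eq_inv', smul_eq_mul]
  exact (hdet.inv hx).mul hadj

theorem CoordMem.congr {E M : Type*} [NormedAddCommGroup E] [NormedSpace ℝ E] [AddCommGroup M]
    [Module ℂ M] {x : E} {F G : E → M} (hF : CoordMem (differentiableAtPoint x) F)
    (h : G =ᶠ[nhds x] F) : CoordMem (differentiableAtPoint x) G := fun l =>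
  DifferentiableAt.congr_of_eventuallyEq (hF l) (h.mono fun _ hy => congrArg l hy)

/-- A left inverse near a point of a differentiable family of endomorphisms. -/
theorem exists_inverse {E M : Type*} [NormedAddCommGroup E] [NormedSpace ℝ E] [AddCommGroup M]
    [Module ℂ M] [FiniteDimensional ℂ M] {x : E} {F : E → Module.End ℂ M}
    (hF : CoordMem (differentiableAtPoint x) F) (hx : F x = 1) :
    ∃ T : E → Module.End ℂ M, CoordMem (differentiableAtPoint x) T ∧
      ∀ᶠ y in nhds x, F y * T y = 1 := by
  let b := Module.finBasis ℂ M
  let A : E → Matrix _ _ ℂ := fun y => LinearMap.toMatrix b b (F y)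
  have hA : ∀ i j, DifferentiableAt ℝ (fun y => A y i j) x := fun i j =>
    hF (Matrix.entryLinearMap ℂ ℂ i j ∘ₗ (LinearMap.toMatrix b b).toLinearMap)
  have hAx : (A x).det ≠ 0 := by simp [A, hx]
  have hcont : ContinuousAt (fun y => (A y).det) x :=
    (det_mem (S := differentiableAtPoint x) hA : DifferentiableAt ℝ _ x).continuousAt
  refine ⟨fun y => Matrix.toLin b b (A y)⁻¹, ?_, ?_⟩
  · have : CoordMem (differentiableAtPoint x) (fun y => (A y)⁻¹) := by
      refine CoordMem.of_basis (Matrix.stdBasis ℂ _ _) fun p => ?_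
      exact (differentiableAt_inv_apply hA hAx p.1 p.2 :)
    exact this.map (Matrix.toLin b b).toLinearMap
  · filter_upwards [hcont.eventually_ne hAx] with y hy
    have h := Matrix.toLin_mul b b b (A y) (A y)⁻¹
    rw [Matrix.mul_nonsing_inv _ (isUnit_iff_ne_zero.2 hy), Matrix.toLin_one,
      Matrix.toLin_toMatrix] at h
    exact h.symm

end Determinant

/-! ### Conjugates of differentiable families. -/

section ConjugateFamilies

variable {V : Type*} [AddCommGroup V] [Module ℚ V]

/-- Complex conjugation of linear forms on endomorphisms. -/
def conjDual (l : Module.Dual ℂ (Module.End ℂ (ComplexPts V))) :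
    Module.Dual ℂ (Module.End ℂ (ComplexPts V)) where
  toFun A := starRingEnd ℂ (l (conjEnd A))
  map_add' A B := by
    have : conjEnd (A + B) = conjEnd A + conjEnd B :=
      LinearMap.ext fun x => by simp [conjEnd_apply]
    rw [this, map_add, map_add]
  map_smul' a A := by
    have : conjEnd (a • A) = starRingEnd ℂ a • conjEnd A :=
      LinearMap.ext fun x => by simp [conjEnd_apply, LinearMap.map_smulₛₗ]
    rw [this, map_smul, smul_eq_mul, map_mul, Complex.conj_conj]
    rfl

theorem CoordMem.conjEnd {E : Type*} [NormedAddCommGroup E] [NormedSpace ℝ E] {x : E}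
    {F : E → Module.End ℂ (ComplexPts V)} (hF : CoordMem (differentiableAtPoint x) F) :
    CoordMem (differentiableAtPoint x) (fun y => SuperPeriod.conjEnd (F y)) := fun l => by
  have h : DifferentiableAt ℝ (fun y => conjDual l (F y)) x := hF (conjDual l)
  have h2 : DifferentiableAt ℝ (fun y => star (conjDual l (F y))) x := h.star
  have h3 : (fun y => l (SuperPeriod.conjEnd (F y))) = fun y => star (conjDual l (F y)) := by
    funext y
    simp [conjDual]
  exact h3 ▸ h2

theorem PeriodDomain.eq_of_F_eq {Q : LinearMap.BilinForm ℚ V} {k : ℕ}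
    {h : Fin (2 * k + 1) → ℕ} {z z' : PeriodDomain Q k h} (hF : z.F = z'.F) : z = z' := by
  rcases z with ⟨⟨F, _, _, _, _⟩, _, _, _⟩
  rcases z' with ⟨⟨F', _, _, _, _⟩, _, _, _⟩
  change F = F' at hF
  subst hF
  rfl

end ConjugateFamilies

/-! ### Differentiability of the Hodge metric in a chart. -/

namespace HolomorphicChart

variable {V : Type*} [AddCommGroup V] [Module ℚ V] [FiniteDimensional ℚ V]
  {Q : LinearMap.BilinForm ℚ V} {k : ℕ}
  {h : Fin (2 * k + 1) → ℕ} {z : PeriodDomain Q k h} {n : ℕ} (c : HolomorphicChart z n)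

theorem pt_zero : c.pt 0 = z := by
  refine PeriodDomain.eq_of_F_eq (funext fun p => ?_)
  rw [c.filtration 0 c.zero_mem p, c.g_zero]
  exact Submodule.map_id _

theorem frame_zero (a : Fin (Module.finrank ℂ (z.F (k + 1)))) :
    c.frame a 0 = Module.finBasis ℂ (z.F (k + 1)) a := by
  rw [frame, c.g_zero]
  rfl

theorem g_coordMem : CoordMem (differentiableAtPoint 0) c.g := fun l =>
  (((c.holomorphic l).differentiableAt (c.isOpen.mem_nhds c.zero_mem)).restrictScalars ℝ :)

/-- The automorphism `g` on `F^p` and the conjugate of `g` on the conjugate of `F^{2k-p+1}`. -/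
def splitting (p : ℕ) (x : Fin n → ℂ) : Module.End ℂ (ComplexPts V) :=
  c.g x * z.proj p + SuperPeriod.conjEnd (c.g x) * (1 - z.proj p)

theorem splitting_coordMem (p : ℕ) : CoordMem (differentiableAtPoint 0) (c.splitting p) :=
  (c.g_coordMem.mul (CoordMem.const _)).add (c.g_coordMem.conjEnd.mul (CoordMem.const _))

theorem splitting_zero (p : ℕ) : c.splitting p 0 = 1 := by
  have : SuperPeriod.conjEnd (1 : Module.End ℂ (ComplexPts V)) = 1 :=
    LinearMap.ext fun x => conjC_conjC x
  rw [splitting, c.g_zero, this, one_mul, one_mul, add_sub_cancel]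

/-- g maps F^p of z to F^p of the moving point, and its conjugate does the same for the conjugate of
F^{2k+1-p}. The splitting thus respects both decompositions and intertwines the projections. -/
theorem proj_mul_splitting {p : ℕ} (hp : p ≤ 2 * k + 1) {x : Fin n → ℂ} (hx : x ∈ c.U) :
    (c.pt x).proj p * c.splitting p x = c.splitting p x * z.proj p := by
  have hzz : ∀ y, z.proj p (z.proj p y) = z.proj p y := fun y =>
    z.proj_apply_of_mem hp (z.proj_mem p y)
  refine LinearMap.ext fun y => ?_
  have h1 : (c.pt x).proj p (c.g x (z.proj p y)) = c.g x (z.proj p y) := by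
    refine (c.pt x).proj_apply_of_mem hp ?_
    rw [c.filtration x hx p]
    exact Submodule.mem_map_of_mem (z.proj_mem p y)
  have h2 : (c.pt x).proj p (SuperPeriod.conjEnd (c.g x) (y - z.proj p y)) = 0 := by
    refine (c.pt x).proj_apply_of_conjC_mem hp ?_
    rw [conjEnd_apply, conjC_conjC, c.filtration x hx]
    exact Submodule.mem_map_of_mem (z.conjC_sub_proj_mem hp y)
  simp only [splitting, Module.End.mul_apply, LinearMap.add_apply, LinearMap.sub_apply,
    Module.End.one_apply, map_add, h1, h2, hzz, sub_self, map_zero]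

/-- Near the centre the splitting is invertible and conjugates the fixed projection into the moving
one. It mixes g with its conjugate, so the differentiability is real, not complex. -/
theorem proj_coordMem {p : ℕ} (hp : p ≤ 2 * k + 1) :
    CoordMem (differentiableAtPoint 0) (fun x => (c.pt x).proj p) := by
  obtain ⟨T, hT, hT1⟩ := exists_inverse (c.splitting_coordMem p) (c.splitting_zero p)
  refine CoordMem.congr (((c.splitting_coordMem p).mul (CoordMem.const (z.proj p))).mul hT) ?_
  filter_upwards [hT1, c.isOpen.mem_nhds c.zero_mem] with x hx hxU
  have := c.proj_mul_splitting hp hxU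
  change (c.pt x).proj p = c.splitting p x * z.proj p * T x
  rw [← this, mul_assoc, hx, mul_one]

theorem weil_coordMem : CoordMem (differentiableAtPoint 0) (fun x => (c.pt x).weil) := by
  simp only [HodgeStructure.weil_eq_diag, HodgeStructure.diag_eq_sum_proj]
  refine CoordMem.sum fun p _ => CoordMem.const_smul ?_ _
  exact (c.proj_coordMem (by omega)).sub (c.proj_coordMem (by omega))

theorem gram_differentiableAt (a b : Fin (Module.finrank ℂ (z.F (k + 1)))) :
    DifferentiableAt ℝ (fun x => c.gram x a b) 0 := by
  have happ : ∀ (y : ComplexPts V) (F : (Fin n → ℂ) → Module.End ℂ (ComplexPts V)),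
      CoordMem (differentiableAtPoint 0) F → CoordMem (differentiableAtPoint 0) (fun x => F x y) :=
    fun y F hF => hF.map (LinearMap.applyₗ y)
  have h1 : CoordMem (differentiableAtPoint 0) (fun x => (c.pt x).weil (c.frame b x)) :=
    c.weil_coordMem.bilin (happ _ _ c.g_coordMem) LinearMap.id
  have h2 : CoordMem (differentiableAtPoint 0) (fun x => conjC (c.frame a x)) := by
    have := happ (conjC (Module.finBasis ℂ (z.F (k + 1)) a : ComplexPts V)) _ c.g_coordMem.conjEnd
    simp only [conjEnd_apply, conjC_conjC] at this
    exact this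
  have h3 := CoordMem.scalar.1 (h1.bilin h2 (complexForm Q))
  have h4 : DifferentiableAt ℝ (fun x =>
    complexForm Q ((c.pt x).weil (c.frame b x)) (conjC (c.frame a x))) 0 := h3
  simp only [gram, div_eq_mul_inv]
  exact h4.mul_const _

theorem sumGram_differentiableAt (r : ℕ) (a b : SumIndex z r) :
    DifferentiableAt ℝ (fun x => c.sumGram r x a b) 0 := by
  unfold sumGram
  split_ifs
  · exact c.gram_differentiableAt _ _
  · exact differentiableAt_const _

end HolomorphicChart

/-! ### The majorant and the odd endomorphism as functions of v. -/

namespace HolomorphicChart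

open scoped ComplexOrder

variable {V : Type*} [AddCommGroup V] [Module ℚ V]
  [FiniteDimensional ℚ V] {Q : LinearMap.BilinForm ℚ V} {k : ℕ}
  {h : Fin (2 * k + 1) → ℕ} {z : PeriodDomain Q k h} {n : ℕ} (c : HolomorphicChart z n) {r : ℕ}

theorem gram_zero (a b : Fin (Module.finrank ℂ (z.F (k + 1)))) :
    c.gram 0 a b = z.hodgeForm (Module.finBasis ℂ (z.F (k + 1)) b)
      (Module.finBasis ℂ (z.F (k + 1)) a) / 2 := by
  rw [gram, c.pt_zero, c.frame_zero, c.frame_zero]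
  rfl

/-- The vector in the `i`-th copy of `F^{k+1}` with given coordinates. -/
def vec (ξ : SumIndex z r → ℂ) (i : Fin r) : z.F (k + 1) :=
  (Module.finBasis ℂ (z.F (k + 1))).equivFun.symm (fun b => ξ (toLex (i, b)))

theorem coe_vec (ξ : SumIndex z r → ℂ) (i : Fin r) :
    (vec ξ i : ComplexPts V) =
      ∑ b, ξ (toLex (i, b)) • (Module.finBasis ℂ (z.F (k + 1)) b : ComplexPts V) := by
  rw [vec, Module.Basis.equivFun_symm_apply]
  simp

theorem sum_sumIndex {M : Type*} [AddCommMonoid M] (f : SumIndex z r → M) :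
    ∑ p, f p = ∑ i, ∑ b, f (toLex (i, b)) := by
  rw [← Fintype.sum_prod_type' (f := fun i b => f (toLex (i, b)))]
  exact (Equiv.sum_comp toLex f).symm

theorem dotProduct_sumGram (ξ : SumIndex z r → ℂ) :
    star ξ ⬝ᵥ (c.sumGram r 0).mulVec ξ = ∑ i, z.hodgeForm (vec ξ i) (vec ξ i) / 2 := by
  simp only [dotProduct, Matrix.mulVec, sum_sumIndex]
  refine Finset.sum_congr rfl fun i _ => ?_
  have h1 : z.hodgeForm (vec ξ i) (vec ξ i) = ∑ b, ∑ a, ξ (toLex (i, b)) *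
      starRingEnd ℂ (ξ (toLex (i, a))) * z.hodgeForm (Module.finBasis ℂ (z.F (k + 1)) b)
      (Module.finBasis ℂ (z.F (k + 1)) a) := by
    simp only [PeriodDomain.hodgeForm, coe_vec, map_sum, map_smul, LinearMap.sum_apply,
      LinearMap.smul_apply, LinearMap.map_smulₛₗ, smul_eq_mul, Finset.mul_sum, mul_assoc]
    rw [Finset.sum_comm]
    exact Finset.sum_congr rfl fun b _ => Finset.sum_congr rfl fun a _ => mul_left_comm _ _ _
  rw [h1, Finset.sum_comm, Finset.sum_div]
  refine Finset.sum_congr rfl fun a _ => ?_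
  rw [Finset.sum_eq_single i]
  · rw [Finset.mul_sum, Finset.sum_div]
    refine Finset.sum_congr rfl fun b _ => ?_
    simp only [sumGram, ofLex_toLex, if_true, c.gram_zero, Pi.star_apply, RCLike.star_def]
    ring
  · intro j _ hj
    refine Finset.sum_eq_zero fun b _ => ?_
    simp [sumGram, hj.symm]
  · simp

theorem sumSection_zero (v : Fin r → RealPts V) (i : Fin r)
    (b : Fin (Module.finrank ℂ (z.F (k + 1)))) :
    c.sumSection v 0 (toLex (i, b)) =
      complexForm Q (Module.finBasis ℂ (z.F (k + 1)) b) (realToComplex (v i)) := by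
  rw [sumSection, ofLex_toLex, c.frame_zero]

theorem sumSection_dotProduct (v : Fin r → RealPts V) (ξ : SumIndex z r → ℂ) :
    c.sumSection v 0 ⬝ᵥ ξ = ∑ i, complexForm Q (vec ξ i) (realToComplex (v i)) := by
  simp only [dotProduct, sum_sumIndex, coe_vec, map_sum, map_smul, LinearMap.sum_apply,
    LinearMap.smul_apply, smul_eq_mul, c.sumSection_zero]
  exact Finset.sum_congr rfl fun i _ => Finset.sum_congr rfl fun b _ => mul_comm _ _

theorem posDef_sumGram (hQ : Q.IsSymm) (r : ℕ) : (c.sumGram r 0).PosDef := by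
  refine Matrix.PosDef.of_dotProduct_mulVec_pos ?_ fun ξ hξ => ?_
  · ext p q
    rw [Matrix.conjTranspose_apply, sumGram, sumGram]
    by_cases hpq : (ofLex p).1 = (ofLex q).1
    · simp only [hpq, if_true, c.gram_zero, RCLike.star_def, map_div₀, z.hodgeForm_conj hQ,
        map_ofNat]
    · simp [hpq, Ne.symm hpq]
  · rw [c.dotProduct_sumGram]
    have hnn : ∀ i, 0 ≤ z.hodgeForm (vec ξ i) (vec ξ i) / 2 := fun i => by
      by_cases h0 : (vec ξ i : ComplexPts V) = 0
      · simp [h0, PeriodDomain.hodgeForm]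
      · exact div_nonneg (z.hodgeForm_self_pos h0).le (by norm_num)
    obtain ⟨p, hp⟩ := Function.ne_iff.1 hξ
    refine Finset.sum_pos' (fun i _ => hnn i) ⟨(ofLex p).1, Finset.mem_univ _, ?_⟩
    refine div_pos (z.hodgeForm_self_pos fun h0 => hp ?_) (by norm_num)
    have h1 : vec ξ (ofLex p).1 = 0 := Subtype.ext h0
    rw [vec, LinearEquiv.map_eq_zero_iff] at h1
    exact congrFun h1 (ofLex p).2

/-- The squared norm of the linear form `(s_{v_1}, …, s_{v_r})` at the center of the chart. -/
def normSq (v : Fin r → RealPts V) : ℂ :=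
  c.sumSection v 0 ⬝ᵥ (c.sumGram r 0)⁻¹.mulVec (star (c.sumSection v 0))

/-- The majorant of the quadratic form `∑ Q(v_i, v_i)` defined by the Hodge structure. -/
def majorant (v : Fin r → RealPts V) : ℝ := ∑ i, realForm Q (v i) (v i) + 2 * (c.normSq v).re

theorem normSq_eq_re (hQ : Q.IsSymm) (v : Fin r → RealPts V) :
    c.normSq v = ((c.normSq v).re : ℂ) :=
  Complex.ext rfl (dual_norm_bound (c.posDef_sumGram hQ r) (c.sumSection v 0) 0).1

/-- Assemble ξ from the vectors e_i of `exists_majorant`. Since s(ξ) = ∑ N_i and ξ has squared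
length ∑ N_i / 2, `dual_norm_bound` gives |s|² ≥ 2 ∑ N_i, so the majorant is at least ∑ (Q(v_i,v_i)
+ 4 N_i). -/
theorem majorant_pos (hQ : Q.IsSymm) {v : Fin r → RealPts V} (hv : v ≠ 0) : 0 < c.majorant v := by
  choose e he N hN1 hN2 hnn hpos using fun i => z.exists_majorant hQ (v i)
  let ξ : SumIndex z r → ℂ := fun p =>
    (Module.finBasis ℂ (z.F (k + 1))).equivFun ⟨e (ofLex p).1, he (ofLex p).1⟩ (ofLex p).2
  have hvec : ∀ i, (vec ξ i : ComplexPts V) = e i := fun i => by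
    have : vec ξ i = ⟨e i, he i⟩ :=
      (Module.finBasis ℂ (z.F (k + 1))).equivFun.symm_apply_apply ⟨e i, he i⟩
    rw [this]
  have hb := (dual_norm_bound (c.posDef_sumGram hQ r) (c.sumSection v 0) ξ).2
  have h1 : c.sumSection v 0 ⬝ᵥ ξ = ((∑ i, N i : ℝ) : ℂ) := by
    rw [c.sumSection_dotProduct, Complex.ofReal_sum]
    exact Finset.sum_congr rfl fun i _ => by rw [hvec, hN1]
  have h2 : star ξ ⬝ᵥ (c.sumGram r 0).mulVec ξ = ((∑ i, N i / 2 : ℝ) : ℂ) := by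
    rw [c.dotProduct_sumGram, Complex.ofReal_sum]
    exact Finset.sum_congr rfl fun i _ => by rw [hvec, hN2]; push_cast; rfl
  rw [h1, h2, Complex.ofReal_re, Complex.ofReal_re, ← Finset.sum_div] at hb
  obtain ⟨i, hi⟩ := Function.ne_iff.1 hv
  have hsum : 0 < ∑ i, (realForm Q (v i) (v i) + 4 * N i) :=
    Finset.sum_pos' (fun i _ => hnn i) ⟨i, Finset.mem_univ _, hpos i hi⟩
  rw [Finset.sum_add_distrib, ← Finset.mul_sum] at hsum
  have : 2 * ∑ i, N i ≤ (c.normSq v).re := by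
    refine le_trans (le_of_eq ?_) hb
    ring
  rw [majorant]
  linarith

theorem oddPart_mul_self (hQ : Q.IsSymm) (v : Fin r → RealPts V) :
    c.oddPart v 0 * c.oddPart v 0 = (-(2 * Real.pi) * c.normSq v : ℂ) • 1 := by
  have hI : (Complex.I * (Real.sqrt (2 * Real.pi) : ℂ)) * (Complex.I * (Real.sqrt (2 * Real.pi) : ℂ))
      = -(2 * Real.pi) := by
    rw [mul_mul_mul_comm, Complex.I_mul_I, ← Complex.ofReal_mul,
      Real.mul_self_sqrt (by positivity)]
    push_cast
    ring
  rw [oddPart, Matrix.smul_mul, Matrix.mul_smul, smul_smul, hI, koszulGram,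
    koszulMatrix_add_metricAdjoint_mul_self (c.posDef_sumGram hQ r).isUnit, smul_smul, normSq]

/-- The linear form `(s_{v_1}, …, s_{v_r})` as a linear function of `(v_1, …, v_r)`. -/
def sectionLinear (r : ℕ) (x : Fin n → ℂ) : (Fin r → RealPts V) →ₗ[ℝ] SumIndex z r → ℂ where
  toFun v := c.sumSection v x
  map_add' v w := by
    funext p
    simp [sumSection]
  map_smul' a v := by
    funext p
    simp [sumSection, realToComplex_smul]

/-- The odd endomorphism as a linear function of `(v_1, …, v_r)`. -/
def oddLinear (r : ℕ) (x : Fin n → ℂ) :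
    (Fin r → RealPts V) →ₗ[ℝ] Matrix (Finset (SumIndex z r)) (Finset (SumIndex z r)) ℂ where
  toFun v := c.oddPart v x
  map_add' v w := by
    have h : c.sumSection (v + w) x = c.sumSection v x + c.sumSection w x :=
      (c.sectionLinear r x).map_add v w
    simp only [oddPart, h, ← koszulLinear_apply, map_add, metricAdjoint, Matrix.conjTranspose_add,
      Matrix.mul_add, Matrix.add_mul, smul_add]
    abel
  map_smul' a v := by
    have h : c.sumSection (a • v) x = (a : ℂ) • c.sumSection v x :=
      (c.sectionLinear r x).map_smul a v
    simp only [oddPart, h, ← koszulLinear_apply, map_smul, metricAdjoint,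
      Matrix.conjTranspose_smul, Matrix.mul_smul, Matrix.smul_mul, RCLike.star_def,
      Complex.conj_ofReal, RingHom.id_apply, ← smul_add]
    rw [smul_comm]
    rfl

theorem sumSection_differentiableAt (v : Fin r → RealPts V) (p : SumIndex z r) :
    DifferentiableAt ℝ (fun x => c.sumSection v x p) 0 :=
  c.g_coordMem ((complexForm Q).flip (realToComplex (v (ofLex p).1)) ∘ₗ
    LinearMap.applyₗ (Module.finBasis ℂ (z.F (k + 1)) (ofLex p).2 : ComplexPts V))

/-- Near the centre the Gram matrix is invertible, and there the adjoint is multiplication by G⁻¹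
applied to the conjugate of s, whose entries are differentiable. -/
theorem oddPart_differentiableAt (hQ : Q.IsSymm) (v : Fin r → RealPts V)
    (S T : Finset (SumIndex z r)) : DifferentiableAt ℝ (fun x => c.oddPart v x S T) 0 := by
  have hdet : (c.sumGram r 0).det ≠ 0 :=
    ((Matrix.isUnit_iff_isUnit_det _).1 (c.posDef_sumGram hQ r).isUnit).ne_zero
  have hcont : ContinuousAt (fun x => (c.sumGram r x).det) 0 :=
    (det_mem (S := differentiableAtPoint 0) (c.sumGram_differentiableAt r) :
      DifferentiableAt ℝ _ _).continuousAt
  have hs : CoordMem (differentiableAtPoint 0) (fun x => c.sumSection v x) :=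
    CoordMem.pi fun p => CoordMem.scalar.2 (c.sumSection_differentiableAt v p)
  have hdual : CoordMem (differentiableAtPoint 0)
      (fun x => (c.sumGram r x)⁻¹.mulVec (star (c.sumSection v x))) := by
    refine CoordMem.pi fun p => CoordMem.scalar.2 ?_
    have : ∀ q, DifferentiableAt ℝ
        (fun x => (c.sumGram r x)⁻¹ p q * star (c.sumSection v x q)) 0 := fun q =>
      (differentiableAt_inv_apply (c.sumGram_differentiableAt r) hdet p q).mul
        (c.sumSection_differentiableAt v q).star
    exact (DifferentiableAt.fun_sum (u := Finset.univ) fun q _ => this q :)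
  let wedgeLinear : (SumIndex z r → ℂ) →ₗ[ℂ]
      Matrix (Finset (SumIndex z r)) (Finset (SumIndex z r)) ℂ :=
    (Matrix.transposeLinearEquiv _ _ ℂ ℂ).toLinearMap ∘ₗ koszulLinear (SumIndex z r)
  have hmat : CoordMem (differentiableAtPoint 0) (fun x => c.oddPart v x) := by
    refine CoordMem.congr (((hs.map (koszulLinear _)).add (hdual.map wedgeLinear)).const_smul
      (Complex.I * (Real.sqrt (2 * Real.pi) : ℂ))) ?_
    filter_upwards [hcont.eventually_ne hdet] with x hx
    have hu : IsUnit (c.sumGram r x) :=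
      (Matrix.isUnit_iff_isUnit_det _).2 (isUnit_iff_ne_zero.2 hx)
    rw [oddPart, koszulGram, metricAdjoint_koszulMatrix hu, ← koszulMatrix_transpose]
    rfl
  exact hmat (Matrix.entryLinearMap ℂ ℂ S T)

theorem normSq_mem : c.normSq (r := r) ∈ temperateGrowth (Fin r → RealPts V) := by
  have hs : ∀ p, (fun v => c.sumSection v 0 p) ∈ temperateGrowth (Fin r → RealPts V) := fun p =>
    temperateGrowth_of_linear (LinearMap.proj p ∘ₗ c.sectionLinear r 0)
  have hs' : ∀ p, (fun v => star (c.sumSection v 0 p)) ∈ temperateGrowth (Fin r → RealPts V) :=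
    fun p => temperateGrowth_of_linear (Complex.conjAe.toLinearMap ∘ₗ
      (LinearMap.proj p : (SumIndex z r → ℂ) →ₗ[ℝ] ℂ) ∘ₗ c.sectionLinear r 0)
  have h : c.normSq (r := r) = ∑ p, (fun v => c.sumSection v 0 p) * ∑ q,
      algebraMap ℂ _ ((c.sumGram r 0)⁻¹ p q) * fun v => star (c.sumSection v 0 q) := by
    funext v
    simp [normSq, dotProduct, Matrix.mulVec]
  rw [h]
  exact Subalgebra.sum_mem _ fun p _ => Subalgebra.mul_mem _ (hs p) (Subalgebra.sum_mem _
    fun q _ => Subalgebra.mul_mem _ (Subalgebra.algebraMap_mem _ _) (hs' q))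

theorem majorant_hasTemperateGrowth :
    (c.majorant (r := r)).HasTemperateGrowth := by
  have h1 : ∀ i : Fin r, (fun v : Fin r → RealPts V =>
      realForm Q (v i) (v i)).HasTemperateGrowth := fun i => by
    let L : (Fin r → RealPts V) →L[ℝ] RealPts V := ContinuousLinearMap.proj i
    let B : RealPts V →L[ℝ] RealPts V →L[ℝ] ℝ :=
      LinearMap.toContinuousLinearMap
        ((LinearMap.toContinuousLinearMap : (RealPts V →ₗ[ℝ] ℝ) ≃ₗ[ℝ] _).toLinearMap ∘ₗ realForm Q)
    exact B.bilinear_hasTemperateGrowth L.hasTemperateGrowth L.hasTemperateGrowth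
  have h2 : (fun v : Fin r → RealPts V => (c.normSq v).re).HasTemperateGrowth :=
    Complex.reCLM.hasTemperateGrowth.comp (c.normSq_mem : Function.HasTemperateGrowth _)
  exact (Function.HasTemperateGrowth.sum fun i _ => h1 i).add
    ((Function.HasTemperateGrowth.const (2 : ℝ)).mul h2)

theorem majorant_smul (a : ℝ) (v : Fin r → RealPts V) :
    c.majorant (a • v) = a ^ 2 * c.majorant v := by
  have h : c.sumSection (a • v) 0 = (a : ℂ) • c.sumSection v 0 :=
    (c.sectionLinear r 0).map_smul a v
  have h2 : c.normSq (a • v) = ((a ^ 2 : ℝ) : ℂ) * c.normSq v := by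
    simp only [normSq, h, star_smul, Matrix.mulVec_smul, dotProduct_smul, smul_dotProduct,
      smul_eq_mul, RCLike.star_def, Complex.conj_ofReal]
    push_cast
    ring
  rw [majorant, majorant, h2, Complex.re_ofReal_mul, mul_add, Finset.mul_sum]
  congr 1
  · refine Finset.sum_congr rfl fun i _ => ?_
    simp only [Pi.smul_apply, map_smul, LinearMap.smul_apply, smul_eq_mul]
    ring
  · ring

end HolomorphicChart

/-! ### From a definite quadratic form to the tensor product with Schwartz functions. -/

section Schwartz

variable {W : Type*} [NormedAddCommGroup W] [NormedSpace ℝ W]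

/-- A continuous positive definite quadratic form dominates the square of the norm. -/
theorem exists_mul_norm_sq_le [FiniteDimensional ℝ W] {q : W → ℝ} (hq : Continuous q)
    (hsmul : ∀ (a : ℝ) v, q (a • v) = a ^ 2 * q v) (hpos : ∀ v, v ≠ 0 → 0 < q v) :
    ∃ C > 0, ∀ v, C * ‖v‖ ^ 2 ≤ q v := by
  have h0 : q 0 = 0 := by simpa using hsmul 0 0
  -- The zero space has an empty unit sphere and is treated apart; otherwise C is the minimum of q
  -- on the sphere.
  rcases subsingleton_or_nontrivial W with hW | hW
  · exact ⟨1, one_pos, fun v => by rw [Subsingleton.elim v 0, h0]; simp⟩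
  · have := FiniteDimensional.proper ℝ W
    obtain ⟨v₀, hv₀, hmin⟩ := (isCompact_sphere (0 : W) 1).exists_isMinOn
      (NormedSpace.sphere_nonempty.2 zero_le_one) hq.continuousOn
    refine ⟨q v₀, hpos v₀ (ne_zero_of_mem_unit_sphere ⟨v₀, hv₀⟩), fun v => ?_⟩
    by_cases hv : v = 0
    · simp [hv, h0]
    · have hn : ‖v‖ ≠ 0 := norm_ne_zero_iff.2 hv
      have h1 : q v₀ ≤ q (‖v‖⁻¹ • v) := hmin (by simp [norm_smul, hn])
      rw [hsmul, inv_pow] at h1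
      calc q v₀ * ‖v‖ ^ 2 ≤ (‖v‖ ^ 2)⁻¹ * q v * ‖v‖ ^ 2 := by gcongr
        _ = q v := by field_simp

/-- The product of a scalar Schwartz function and a function of temperate growth with values in a
finite-dimensional space belongs to the tensor product of the space of Schwartz functions. -/
theorem exists_evalAt_eq {A I : Type*} [AddCommGroup A] [Module ℂ A] [Fintype I]
    (b : Module.Basis I ℂ A) (f : SchwartzMap W ℂ) {P : W → A}
    (hP : CoordMem (temperateGrowth W) P) :
    ∃ Φ : SchwartzMap W ℂ ⊗[ℂ] A, ∀ v, evalAt v Φ = f v • P v := by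
  refine ⟨∑ i, (SchwartzMap.smulLeftCLM ℂ (fun v => b.coord i (P v)) f) ⊗ₜ b i, fun v => ?_⟩
  rw [map_sum]
  conv_rhs => rw [← b.sum_repr (P v), Finset.smul_sum]
  refine Finset.sum_congr rfl fun i _ => ?_
  have hi : Function.HasTemperateGrowth (fun v => b.coord i (P v)) := hP (b.coord i)
  rw [evalAt, TensorProduct.lift.tmul]
  change (SchwartzMap.smulLeftCLM ℂ (fun v => b.coord i (P v)) f v) • b i = _
  rw [SchwartzMap.smulLeftCLM_apply_apply hi, smul_smul, smul_eq_mul, mul_comm]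
  rfl

end Schwartz

end SuperPeriod

end

theorem mainTheorem7 {V : Type*} [AddCommGroup V] [Module ℚ V] [FiniteDimensional ℚ V]
    (Q : LinearMap.BilinForm ℚ V) (hQ : Q.IsSymm) (k : ℕ) (h : Fin (2 * k + 1) → ℕ)
    (z : SuperPeriod.PeriodDomain Q k h) (n : ℕ) (c : SuperPeriod.HolomorphicChart z n) (r : ℕ) :
    ∃ Φ : TensorProduct ℂ (SchwartzMap (Fin r → SuperPeriod.RealPts V) ℂ) (SuperPeriod.Forms n),
      ∀ v : Fin r → SuperPeriod.RealPts V, SuperPeriod.evalAt v Φ = c.phi v := by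
  obtain ⟨P, hP, hphi⟩ := SuperPeriod.supertrace_expEnd_curvature Finset.card (c.koszulGram r)
    (c.oddLinear r) 0 (fun v => c.oddPart_differentiableAt hQ v)
    (fun v => -(2 * Real.pi) * c.normSq v) (c.oddPart_mul_self hQ)
  have hq := c.majorant_hasTemperateGrowth (r := r)
  obtain ⟨C, hC, hle⟩ := SuperPeriod.exists_mul_norm_sq_le hq.1.continuous c.majorant_smul
    (fun _ => c.majorant_pos hQ)
  obtain ⟨f, hf⟩ := SuperPeriod.exists_schwartzMap_exp_neg (q := fun v => Real.pi * c.majorant v)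
    ((Function.HasTemperateGrowth.const Real.pi).mul hq) (c := Real.pi * C) (by positivity)
    (fun v => by
      rw [mul_assoc]
      exact mul_le_mul_of_nonneg_left (hle v) Real.pi_pos.le)
  obtain ⟨Φ, hΦ⟩ := SuperPeriod.exists_evalAt_eq (SuperPeriod.formsBasis n) f hP
  refine ⟨Φ, fun v => ?_⟩
  have hzero : c.phiZero v = Complex.exp (-(2 * Real.pi) * c.normSq v) • P v := hphi v
  rw [hΦ, hf, SuperPeriod.HolomorphicChart.phi, hzero, smul_smul, c.normSq_eq_re hQ v]
  congr 1
  -- The Gaussian factor in the definition of φ and the factor e^{-2π|s|²} from the curvature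
  -- combine into the exponential of -π times the majorant.
  rw [Complex.ofReal_exp, Complex.ofReal_exp, ← Complex.exp_add]
  congr 1
  rw [SuperPeriod.HolomorphicChart.majorant]
  push_cast
  ring
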